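/- **European call, at-the-money-forward price (symmetric Variance Gamma model).** Let $K,\tau,\sigma,\nu>0$ and $r\in\mathbb{R}$ with $\sigma^2\nu<2$, put $\alpha:=\frac{\tau}{\nu}-\frac12$, and assume $\alpha\notin\mathbb{Z}$. Let $X$ be the increment over time $\tau$ of the symmetric Variance Gamma process under the risk-neutral measure $\mathbb{Q}$, i.e. a random variable distributed as $\sigma W(\gamma)$, where $W$ is a standard Brownian motion and $\gamma$ is an independent Gamma variable with mean $\tau$ and variance $\nu\tau$. Let $\omega_{\sigma,\nu}:=\frac1\nu\log\left(1-\frac{\sigma^2\nu}{2}\right)$ be the martingale adjustment, $F:=Ke^{-r\tau}$, $\sigma_\nu:=\sigma\sqrt{\nu/2}$, and $k_{\sigma,\nu}:=\log\frac SF+\omega_{\sigma,\nu}\tau$. As $\sigma\to0^+$ (with $\nu$ fixed), $\omega_{\sigma,\nu}\sim-\frac{\sigma^2}{2}$. Suppose $S=F$, and replace $\omega_{\sigma,\nu}$ by $-\frac{\sigma^2}{2}$ in the model, so that $S_T=Se^{(r-\sigma^2/2)\tau+X}$ and $-k_{\sigma,\nu}$ becomes $\frac{\sigma^2\tau}{2}$.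 Then the European call payoff $[S_T-K]^+$ is $\mathbb{Q}$-integrable, and the call value $$C_{eur}^{ATM}(S,r,\tau,\sigma,\nu)=\mathbb{E}^{\mathbb{Q}}\left[e^{-r\tau}[S_T-K]^+\right]$$ is given by the out-of-the-money European series $$\frac{F}{2\Gamma(\frac{\tau}{\nu})}\sum_{n_1\ge0,\;n_2\ge1}\frac{(-1)^{n_1}}{n_1!}\left[\frac{\Gamma(\frac{-n_1+n_2+1}{2}+\alpha)}{\Gamma(\frac{-n_1+n_2}{2}+1)}\left(\frac{-k_{\sigma,\nu}}{\sigma_\nu}\right)^{n_1}\sigma_\nu^{n_2}+2\,\frac{\Gamma(-2n_1-n_2-1-2\alpha)}{\Gamma(-n_1+\frac12-\alpha)}\left(\frac{-k_{\sigma,\nu}}{\sigma_\nu}\right)^{2n_1+1+2\alpha}(-k_{\sigma,\nu})^{n_2}\right]$$ with $-k_{\sigma,\nu}$ replaced by $\frac{\sigma^2\tau}{2}$; explicitly, $$C_{eur}^{ATM}(S,r,\tau,\sigma,\nu)=\frac{S}{2\Gamma(\frac{\tau}{\nu})}\sum_{n_1\ge0,\;n_2\ge1}\frac{(-1)^{n_1}}{n_1!}\left[\frac{\Gamma(\frac{-n_1+n_2+1}{2}+\alpha)}{\Gamma(\frac{-n_1+n_2}{2}+1)}\left(\frac{\sigma\tau}{\sqrt{2\nu}}\right)^{n_1}\left(\sigma\sqrt{\frac{\nu}{2}}\right)^{n_2}+2\,\frac{\Gamma(-2n_1-n_2-1-2\alpha)}{\Gamma(-n_1+\frac12-\alpha)}\left(\frac{\sigma\tau}{\sqrt{2\nu}}\right)^{2n_1+1+2\alpha}\left(\frac{\sigma^2\tau}{2}\right)^{n_2}\right].$$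 Both double series converge absolutely. In them, $1/\Gamma$ is $0$ at the poles of $\Gamma$, and a quotient of Gamma functions whose numerator and denominator are both at a pole (which occurs only when $\tau/\nu$ is an integer) is understood as its limit in $\alpha$. -/

import Mathlib

open MeasureTheory ProbabilityTheory Filter Topology Asymptotics

/-- The law at time `t` of the Variance Gamma process `θ γ(t) + σ W(γ(t))`, where `γ` is a Gamma
process with `γ(t)` of mean `t` and variance `ν t` (shape `t/ν`, rate `1/ν`) and `W` is an
independent Brownian motion: the mixture of the normal laws `N(θ y, σ² y)` over the Gamma
law of `y`. -/
noncomputable def vgLaw (σ ν θ t : ℝ) : Measure ℝ :=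
  (gammaMeasure (t / ν) (1 / ν)).bind fun y => gaussianReal (θ * y) (σ ^ 2 * y).toNNReal

/-- The martingale adjustment `ω_{σ,ν}` of the symmetric process. -/
noncomputable def martingaleAdjustment (σ ν : ℝ) : ℝ :=
  1 / ν * Real.log (1 - σ ^ 2 * ν / 2)

/-- The forward strike price `F`. -/
noncomputable def forwardStrike (K r τ : ℝ) : ℝ := K * Real.exp (-(r * τ))

/-- The risk-neutral moneyness `log (S / F) + ω τ` computed with the adjustment `ω`. -/
noncomputable def moneyness (S K r τ ω : ℝ) : ℝ :=
  Real.log (S / forwardStrike K r τ) + ω * τ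

/-- The re-scaled volatility `σ_ν`. -/
noncomputable def rescaledVol (σ ν : ℝ) : ℝ := σ * Real.sqrt (ν / 2)

/-- The terminal asset price `S_T` in the exponential model with adjustment `ω`, when the driving
process moves by `x` over the remaining time `τ`. -/
noncomputable def terminalPrice (S r τ ω x : ℝ) : ℝ := S * Real.exp ((r + ω) * τ + x)

/-- The European call payoff `[S_T - K]⁺`. -/
noncomputable def callPayoff (ST K : ℝ) : ℝ := max (ST - K) 0

/-- The value of a European call: the risk-neutral expectation of the discounted payoff, where the
driving process moves by the random variable `X` over the remaining time `τ`. -/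
noncomputable def callValue {Ω : Type*} [MeasurableSpace Ω] (Q : Measure Ω) (X : Ω → ℝ)
    (S K r τ ω : ℝ) : ℝ :=
  ∫ a, Real.exp (-(r * τ)) * callPayoff (terminalPrice S r τ ω (X a)) K ∂Q

/-- The value at `a` of `f` once a removable singularity there is filled in by continuity. -/
noncomputable def continuousValue (f : ℝ → ℝ) (a : ℝ) : ℝ := limUnder (𝓝[≠] a) f

/-- The quotient `Γ((-n₁ + n₂ + 1)/2 + α) / Γ((-n₁ + n₂)/2 + 1)`; when numerator and denominator
are both at a pole it is understood by continuity in `α`. -/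
noncomputable def firstGammaQuotient (α : ℝ) (n₁ n₂ : ℕ) : ℝ :=
  continuousValue (fun β : ℝ =>
    Real.Gamma ((-(n₁ : ℝ) + n₂ + 1) / 2 + β) / Real.Gamma ((-(n₁ : ℝ) + n₂) / 2 + 1)) α

/-- The quotient `Γ(-2n₁ - n₂ - 1 - 2α) / Γ(-n₁ + 1/2 - α)`; when numerator and denominator
are both at a pole it is understood by continuity in `α`. -/
noncomputable def secondGammaQuotient (α : ℝ) (n₁ n₂ : ℕ) : ℝ :=
  continuousValue (fun β : ℝ =>
    Real.Gamma (-2 * (n₁ : ℝ) - n₂ - 1 - 2 * β) / Real.Gamma (-(n₁ : ℝ) + 1 / 2 - β)) α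

/-- The `(n₁, n₂)` term of the out-of-the-money European double series in the moneyness `k` and
the re-scaled volatility `s`. -/
noncomputable def europeanOTMTerm (α k s : ℝ) (n₁ n₂ : ℕ) : ℝ :=
  (-1) ^ n₁ / (n₁.factorial : ℝ) *
    (firstGammaQuotient α n₁ n₂ * (-k / s) ^ n₁ * s ^ n₂
      + 2 * secondGammaQuotient α n₁ n₂ * (-k / s) ^ (2 * (n₁ : ℝ) + 1 + 2 * α) * (-k) ^ n₂)

/-! At the money the discounted call value is `F` times `∫ f(x) max(e^(x-κ) - 1, 0) dx`, where `κ =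
σ²τ/2 > 0` and `f` is the Variance Gamma density. Integrating the Gaussian against the Gamma law
expresses `f` through `besselIntegral α` at `(x/(2s))²` (`vgLaw_eq_withDensity`). Since `κ > 0`, the
integral over `(κ, ∞)` is the integral of `f(x) (e^(x-κ) - 1)` over `(0, ∞)` minus that over `(0,
κ]`.

Over `(0, ∞)` the value is `e^(-κ) ∫ f e^x - ∫ f`. Expanding `e^(-κ)` and `e^x` and inserting the
half-line moments of `f` gives the first-quotient terms with `n₁ ≤ n₂` (`hasSum_firstTerm_of_le`).

Over `(0, κ]`, for non-integer `α`, `f` is an even power series plus `x^(2α)` times another one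
(`besselIntegral_eq`, `hasSum_vgDensity`). Integrated against the powers of `x - κ`, each monomial
gives a Beta integral. The even series produces the first-quotient terms with `n₁ - n₂` odd and
positive (`hasSum_firstTerm_of_lt`); those with `n₁ - n₂` even and positive vanish because `1/Γ`
does. The other series produces the second-quotient terms (`secondTerm_eq`), after the reflection
and duplication formulas. `HasSum` in `ℝ` is unconditional, so it contains absolute convergence. -/

/-! ### Incomplete Gamma functions away from the poles -/

/-- The upper incomplete Gamma function `∫_A^∞ t^(p-1) e^(-t) dt`. -/
noncomputable def upperGamma (p A : ℝ) : ℝ := ∫ t in Set.Ioi A, t ^ (p - 1) * Real.exp (-t)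

/-- The power series `∑ (-1)^i A^(p+i) / (i! (p+i))` of the lower incomplete Gamma function. -/
noncomputable def lowerGammaSeries (p A : ℝ) : ℝ :=
  ∑' i : ℕ, (-1) ^ i / (i.factorial : ℝ) * (A ^ (p + i) / (p + i))

theorem hasSum_pow_div_factorial_exp (x : ℝ) :
    HasSum (fun i : ℕ => x ^ i / (i.factorial : ℝ)) (Real.exp x) := by
  rw [Real.exp_eq_exp_ℝ]; exact NormedSpace.expSeries_div_hasSum_exp x

theorem integrableOn_rpow_mul_exp_neg_Ioi (p : ℝ) {A : ℝ} (hA : 0 < A) :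
    IntegrableOn (fun t : ℝ => t ^ p * Real.exp (-t)) (Set.Ioi A) := by
  refine integrable_of_isBigO_exp_neg (b := 1 / 2) (by norm_num) ?_ ?_
  · refine ContinuousOn.mul (fun t ht => ?_) (by fun_prop)
    exact (Real.continuousAt_rpow_const _ _ (Or.inl (hA.trans_le ht).ne')).continuousWithinAt
  · have := (Real.Gamma_integrand_isLittleO p).isBigO
    simpa [mul_comm] using this

theorem upperGamma_add_one (p : ℝ) {A : ℝ} (hA : 0 < A) :
    upperGamma (p + 1) A = p * upperGamma p A + A ^ p * Real.exp (-A) := by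
  have hd : ∀ t ∈ Set.Ici A, HasDerivAt (fun t : ℝ => t ^ p * Real.exp (-t))
      (p * (t ^ (p - 1) * Real.exp (-t)) - t ^ p * Real.exp (-t)) t := by
    intro t ht
    have ht0 : t ≠ 0 := (hA.trans_le ht).ne'
    convert! (Real.hasDerivAt_rpow_const (p := p) (Or.inl ht0)).mul
      ((Real.hasDerivAt_exp (-t)).comp t (hasDerivAt_neg t)) using 1
    simp only [Function.comp]; ring
  have hi1 := (integrableOn_rpow_mul_exp_neg_Ioi (p - 1) hA).const_mul p
  have hi2 := integrableOn_rpow_mul_exp_neg_Ioi p hA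
  have hl : Tendsto (fun t : ℝ => t ^ p * Real.exp (-t)) atTop (𝓝 0) := by
    have := (Real.Gamma_integrand_isLittleO p).isBigO
    have h2 : Tendsto (fun x : ℝ => Real.exp (-(1 / 2) * x)) atTop (𝓝 0) := by
      refine Real.tendsto_exp_atBot.comp ?_
      exact tendsto_id.const_mul_atTop_of_neg (by norm_num)
    simpa [mul_comm] using this.trans_tendsto h2
  have h := integral_Ioi_of_hasDerivAt_of_tendsto' hd (hi1.sub hi2) hl
  rw [integral_sub hi1 hi2, integral_const_mul] at h
  unfold upperGamma
  rw [add_sub_cancel_right]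
  linarith

theorem summable_lowerGammaSeries (p : ℝ) {A : ℝ} (hA : 0 < A) :
    Summable fun i : ℕ => (-1) ^ i / (i.factorial : ℝ) * (A ^ (p + i) / (p + i)) := by
  have h1 : ∀ᶠ i : ℕ in atTop, 1 ≤ p + i :=
    (tendsto_atTop_add_const_left _ p tendsto_natCast_atTop_atTop).eventually_ge_atTop 1
  refine Summable.of_norm_bounded_eventually_nat
    (g := fun i : ℕ => A ^ p * (A ^ i / (i.factorial : ℝ)))
    ((Real.summable_pow_div_factorial A).mul_left _) ?_
  filter_upwards [h1] with i hi
  rw [Real.rpow_add_natCast hA.ne']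
  have : 0 ≤ A ^ p * A ^ i := by positivity
  rw [norm_mul, norm_div, norm_pow, norm_neg, norm_one, one_pow, Real.norm_natCast,
    Real.norm_of_nonneg (by positivity)]
  calc 1 / (i.factorial : ℝ) * (A ^ p * A ^ i / (p + i))
      ≤ 1 / (i.factorial : ℝ) * (A ^ p * A ^ i) := by
        gcongr; exact div_le_self this hi
    _ = _ := by ring

theorem lowerGammaSeries_add_one {p A : ℝ} (hA : 0 < A) (hp : ∀ m : ℕ, p ≠ -m) :
    lowerGammaSeries (p + 1) A = p * lowerGammaSeries p A - A ^ p * Real.exp (-A) := by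
  have he := hasSum_pow_div_factorial_exp (-A)
  have h := ((summable_lowerGammaSeries p hA).hasSum.mul_left p).sub (he.mul_left (A ^ p))
  refine HasSum.tsum_eq ?_
  -- The coefficient `p A^(p+i)/(p+i) - A^(p+i) = -i A^(p+i)/(p+i)` vanishes at `i = 0`, and its
  -- factor `i` shortens `i!`, so the series is the shifted one.
  rw [← hasSum_nat_add_iff' 1] at h
  have h0 : p ≠ 0 := by simpa using hp 0
  simp only [Finset.range_one, Finset.sum_singleton] at h
  convert! h using 1
  · funext i
    have h2 : p + 1 + (i : ℝ) ≠ 0 := fun h => hp (i + 1) (by push_cast; linarith)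
    rw [show p + 1 + (i : ℝ) = p + ((i + 1 : ℕ) : ℝ) by push_cast; ring] at h2 ⊢
    rw [Real.rpow_add_natCast hA.ne', Nat.factorial_succ, neg_pow A]
    have : (i.factorial : ℝ) ≠ 0 := by positivity
    push_cast at h2 ⊢
    field_simp
    ring
  · have e : p * ((-1) ^ 0 / ((Nat.factorial 0 : ℕ) : ℝ) *
        (A ^ (p + ((0 : ℕ) : ℝ)) / (p + ((0 : ℕ) : ℝ)))) = A ^ p := by
      simp; field_simp
    rw [e, lowerGammaSeries]; simp

theorem Gamma_eq_upperGamma_add_of_pos {p A : ℝ} (hA : 0 < A) (hp : 0 < p) :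
    Real.Gamma p = upperGamma p A + lowerGammaSeries p A := by
  have hint := Real.GammaIntegral_convergent hp
  have hF : ∀ i : ℕ, IntegrableOn (fun t : ℝ => (-1) ^ i / (i.factorial : ℝ) * t ^ (p - 1 + i))
      (Set.Ioc 0 A) := fun i => by
    refine Integrable.const_mul ?_ _
    rw [← IntegrableOn, ← intervalIntegrable_iff_integrableOn_Ioc_of_le hA.le]
    exact intervalIntegral.intervalIntegrable_rpow' (by have : (0:ℝ) ≤ i := by positivity
                                                        linarith)
  have hI : ∀ i : ℕ, ∫ t in Set.Ioc 0 A, t ^ (p - 1 + i) = A ^ (p + i) / (p + i) := fun i => by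
    have : (0:ℝ) ≤ i := by positivity
    rw [← intervalIntegral.integral_of_le hA.le, integral_rpow (Or.inl (by linarith)),
      Real.zero_rpow (by linarith), sub_zero, show p - 1 + i + 1 = p + i by ring]
  have hs : HasSum (fun i : ℕ => (-1) ^ i / (i.factorial : ℝ) * (A ^ (p + i) / (p + i)))
      (∫ t in Set.Ioc 0 A, ∑' i : ℕ, (-1) ^ i / (i.factorial : ℝ) * t ^ (p - 1 + i)) := by
    have := hasSum_integral_of_summable_integral_norm hF ?_
    · simpa only [integral_const_mul, hI] using this
    · refine (summable_lowerGammaSeries p hA).norm.congr fun i => ?_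
      have : (0:ℝ) ≤ i := by positivity
      rw [norm_mul, Real.norm_of_nonneg (r := A ^ (p + i) / (p + i)) (by positivity), ← hI,
        ← integral_const_mul]
      refine setIntegral_congr_fun measurableSet_Ioc fun t ht => ?_
      simp only [norm_mul]
      rw [Real.norm_of_nonneg (r := t ^ (p - 1 + i)) (Real.rpow_nonneg ht.1.le _)]
  rw [Real.Gamma_eq_integral hp, ← Set.Ioc_union_Ioi_eq_Ioi hA.le,
    setIntegral_union Set.Ioc_disjoint_Ioi_same measurableSet_Ioi
      (hint.mono_set Set.Ioc_subset_Ioi_self) (hint.mono_set (Set.Ioi_subset_Ioi hA.le)), add_comm]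
  congr 1
  · simp only [upperGamma, mul_comm]
  · rw [lowerGammaSeries, hs.tsum_eq]
    refine setIntegral_congr_fun measurableSet_Ioc fun t ht => ?_
    have h2 := ((hasSum_pow_div_factorial_exp (-t)).mul_right (t ^ (p - 1))).tsum_eq
    rw [← h2]
    refine tsum_congr fun i => ?_
    rw [Real.rpow_add_natCast ht.1.ne', neg_pow t]
    ring

/-- Both sides satisfy `F (p + 1) = p * F p`, since the boundary terms `A^p e^(-A)` cancel. The
identity therefore descends from `p > 0` one unit at a time. -/
theorem Gamma_eq_upperGamma_add {p A : ℝ} (hA : 0 < A) (hp : ∀ m : ℕ, p ≠ -m) :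
    Real.Gamma p = upperGamma p A + lowerGammaSeries p A := by
  obtain ⟨n, hn⟩ := exists_nat_gt (-p)
  induction n generalizing p with
  | zero => exact Gamma_eq_upperGamma_add_of_pos hA (by simpa using hn)
  | succ n ih =>
    have h0 : p ≠ 0 := by simpa using hp 0
    have h := ih (p := p + 1) (fun m h => hp (m + 1) (by push_cast; linarith))
      (by push_cast at hn; linarith)
    rw [Real.Gamma_add_one h0, upperGamma_add_one p hA, lowerGammaSeries_add_one hA hp] at h
    exact mul_left_cancel₀ h0 (by linarith)

/-! ### Expansion of the Bessel integral in powers of `z` -/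

/-- The integral `∫_0^∞ t^(β-1) e^(-t-z/t) dt`, which is `2 z^(β/2) K_β(2√z)` for the modified
Bessel function `K_β`. -/
noncomputable def besselIntegral (β z : ℝ) : ℝ :=
  ∫ t in Set.Ioi 0, t ^ (β - 1) * Real.exp (-t - z / t)

theorem integrableOn_besselIntegrand_Ioi (β : ℝ) {z A : ℝ} (hz : 0 ≤ z) (hA : 0 < A) :
    IntegrableOn (fun t : ℝ => t ^ (β - 1) * Real.exp (-t - z / t)) (Set.Ioi A) := by
  refine (integrableOn_rpow_mul_exp_neg_Ioi (β - 1) hA).mono' ?_ ?_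
  · exact (by fun_prop : Measurable fun t : ℝ => t ^ (β - 1) * Real.exp (-t - z / t)).aestronglyMeasurable
  · refine (ae_restrict_iff' measurableSet_Ioi).2 (.of_forall fun t ht => ?_)
    have ht0 : 0 < t := hA.trans ht
    rw [Real.norm_of_nonneg (by positivity)]
    gcongr
    have : 0 ≤ z / t := by positivity
    linarith

/-- The change of variables `t = z / u`. -/
theorem integrableOn_and_setIntegral_besselIntegrand_inv (β : ℝ) {z A : ℝ} (hz : 0 < z)
    (hA : 0 < A) :
    IntegrableOn (fun t : ℝ => t ^ (β - 1) * Real.exp (-t - z / t)) (Set.Ioo 0 A) ∧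
    ∫ t in Set.Ioo 0 A, t ^ (β - 1) * Real.exp (-t - z / t) =
      z ^ β * ∫ u in Set.Ioi (z / A), u ^ (-β - 1) * Real.exp (-u - z / u) := by
  have him : (fun u : ℝ => z / u) '' Set.Ioi (z / A) = Set.Ioo 0 A := by
    ext t
    constructor
    · rintro ⟨u, hu, rfl⟩
      have hu0 : 0 < u := lt_trans (by positivity) hu
      refine ⟨by positivity, ?_⟩
      rw [Set.mem_Ioi, div_lt_iff₀ hA] at hu
      simp only
      rw [div_lt_iff₀ hu0]; linarith
    · rintro ⟨h0, h1⟩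
      refine ⟨z / t, ?_, by field_simp⟩
      exact div_lt_div_of_pos_left hz h0 h1
  have hd : ∀ u ∈ Set.Ioi (z / A),
      HasDerivWithinAt (fun u : ℝ => z / u) (-z / u ^ 2) (Set.Ioi (z / A)) u := fun u hu => by
    have hu0 : u ≠ 0 := (lt_trans (by positivity) hu).ne'
    have := ((hasDerivAt_inv hu0).const_mul z).hasDerivWithinAt (s := Set.Ioi (z / A))
    convert! this using 1
    field_simp
  have hinj : Set.InjOn (fun u : ℝ => z / u) (Set.Ioi (z / A)) := fun u hu v hv h => by
    have hu0 : u ≠ 0 := (lt_trans (by positivity) hu).ne'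
    have hv0 : v ≠ 0 := (lt_trans (by positivity) hv).ne'
    simp only at h
    field_simp at h
    exact h.symm
  have hcongr : Set.EqOn (fun u : ℝ => |-z / u ^ 2| •
        ((z / u) ^ (β - 1) * Real.exp (-(z / u) - z / (z / u))))
      (fun u => z ^ β * (u ^ (-β - 1) * Real.exp (-u - z / u))) (Set.Ioi (z / A)) := fun u hu => by
    have hu0 : 0 < u := lt_trans (by positivity) hu
    have h1 : |-z / u ^ 2| = z / u ^ 2 := by
      rw [abs_div, abs_neg, abs_of_pos hz, abs_of_pos (by positivity)]
    have h2 : z / (z / u) = u := by field_simp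
    simp only [smul_eq_mul]
    rw [h1, h2, Real.div_rpow hz.le hu0.le, Real.rpow_sub_one hz.ne',
      Real.rpow_sub_one hu0.ne', Real.rpow_sub_one hu0.ne', Real.rpow_neg hu0.le,
      show -(z / u) - u = -u - z / u by ring]
    have := (Real.rpow_pos_of_pos hu0 β).ne'
    field_simp
  constructor
  · rw [← him, integrableOn_image_iff_integrableOn_abs_deriv_smul measurableSet_Ioi hd hinj]
    refine IntegrableOn.congr_fun ?_ hcongr.symm measurableSet_Ioi
    exact (integrableOn_besselIntegrand_Ioi (-β) hz.le (by positivity)).const_mul _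
  · rw [← him, integral_image_eq_integral_abs_deriv_smul measurableSet_Ioi hd hinj,
      setIntegral_congr_fun measurableSet_Ioi hcongr, integral_const_mul]

theorem hasSum_setIntegral_besselIntegrand_Ioi (β : ℝ) {z A : ℝ} (hz : 0 ≤ z) (hA : 0 < A) :
    HasSum (fun j : ℕ => (-z) ^ j / (j.factorial : ℝ) * upperGamma (β - j) A)
      (∫ t in Set.Ioi A, t ^ (β - 1) * Real.exp (-t - z / t)) := by
  have key : ∀ t ∈ Set.Ioi A, ∀ j : ℕ, (-z) ^ j / (j.factorial : ℝ) * (t ^ (β - j - 1) * Real.exp (-t))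
      = (-z / t) ^ j / (j.factorial : ℝ) * (t ^ (β - 1) * Real.exp (-t)) := fun t ht j => by
    have ht0 : 0 < t := hA.trans ht
    rw [show β - j - 1 = β - 1 - j by ring, Real.rpow_sub_natCast ht0.ne', div_pow]
    field_simp
  have hb : ∀ t ∈ Set.Ioi A, HasSum (fun j : ℕ => ‖(-z) ^ j / (j.factorial : ℝ) *
      (t ^ (β - j - 1) * Real.exp (-t))‖) (Real.exp (z / t) * (t ^ (β - 1) * Real.exp (-t))) := by
    intro t ht
    have ht0 : 0 < t := hA.trans ht
    have := (hasSum_pow_div_factorial_exp (z / t)).mul_right (t ^ (β - 1) * Real.exp (-t))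
    convert! this using 2 with j
    rw [key t ht, norm_mul, Real.norm_of_nonneg (r := t ^ (β - 1) * Real.exp (-t)) (by positivity),
      norm_div, norm_pow, norm_div, norm_neg, Real.norm_of_nonneg hz, Real.norm_of_nonneg ht0.le,
      Real.norm_natCast]
  have := hasSum_integral_of_dominated_convergence (μ := volume.restrict (Set.Ioi A))
    (F := fun (j : ℕ) t => (-z) ^ j / (j.factorial : ℝ) * (t ^ (β - j - 1) * Real.exp (-t)))
    (f := fun t => t ^ (β - 1) * Real.exp (-t - z / t))
    (bound := fun (j : ℕ) t => ‖(-z) ^ j / (j.factorial : ℝ) * (t ^ (β - j - 1) * Real.exp (-t))‖)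
    (fun j => (by fun_prop : Measurable _).aestronglyMeasurable)
    (fun j => .of_forall fun t => le_rfl)
    ((ae_restrict_iff' measurableSet_Ioi).2 (.of_forall fun t ht => (hb t ht).summable)) ?_ ?_
  · simp only [integral_const_mul] at this
    exact this
  -- The sum of the norms is the integrand with `e^(z/t)`, which is at most `e^(z/A)` for `t > A`.
  · have h1 : IntegrableOn (fun t => Real.exp (z / A) * (t ^ (β - 1) * Real.exp (-t))) (Set.Ioi A) :=
      (integrableOn_rpow_mul_exp_neg_Ioi (β - 1) hA).const_mul _
    refine IntegrableOn.congr_fun (f := fun t => Real.exp (z / t) * (t ^ (β - 1) * Real.exp (-t)))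
      ?_ (fun t ht => (hb t ht).tsum_eq.symm) measurableSet_Ioi
    refine h1.mono' ?_ ?_
    · exact (by fun_prop : Measurable _).aestronglyMeasurable
    · refine (ae_restrict_iff' measurableSet_Ioi).2 (.of_forall fun t ht => ?_)
      have ht0 : 0 < t := hA.trans ht
      rw [Real.norm_of_nonneg (by positivity)]
      gcongr
      exact le_of_lt ht
  · refine (ae_restrict_iff' measurableSet_Ioi).2 (.of_forall fun t ht => ?_)
    simp only [key t ht]
    have := (hasSum_pow_div_factorial_exp (-z / t)).mul_right (t ^ (β - 1) * Real.exp (-t))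
    convert! this using 1
    rw [show -t - z / t = -z / t + -t by ring, Real.exp_add]; ring

/-- A single lower bound for all the small divisors `α - m`; it is what makes the series below
converge absolutely. -/
theorem exists_le_abs_sub_int {α : ℝ} (h : ∀ m : ℤ, α ≠ m) : ∃ c > 0, ∀ m : ℤ, c ≤ |α - m| :=
  ⟨|α - round α|, abs_pos.2 (sub_ne_zero.2 (h _)), fun m => round_le α m⟩

/-- Each step down divides `Γ` by a factor of modulus at least `c`, so `|Γ(α - j)|` grows at most
like `c^(-j)`, which `j!` beats. -/
theorem summable_abs_Gamma_sub_nat {α : ℝ} (h : ∀ m : ℤ, α ≠ m) (z : ℝ) :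
    Summable fun j : ℕ => |z ^ j / (j.factorial : ℝ) * Real.Gamma (α - j)| := by
  obtain ⟨c, hc, hcm⟩ := exists_le_abs_sub_int h
  have hb : ∀ j : ℕ, |Real.Gamma (α - j)| * c ^ j ≤ |Real.Gamma α| := by
    intro j
    induction j with
    | zero => simp
    | succ j ih =>
      have h0 : α - (j + 1 : ℕ) ≠ 0 := fun h0 => h (j + 1 : ℕ) (by push_cast at h0 ⊢; linarith)
      have h1 := Real.Gamma_add_one h0
      rw [show α - (j + 1 : ℕ) + 1 = α - j by push_cast; ring] at h1
      rw [h1, abs_mul] at ih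
      have h2 : c ≤ |α - (j + 1 : ℕ)| := by simpa using hcm (j + 1 : ℕ)
      calc _ = c * |Real.Gamma (α - (j + 1 : ℕ))| * c ^ j := by ring
        _ ≤ |α - (j + 1 : ℕ)| * |Real.Gamma (α - (j + 1 : ℕ))| * c ^ j := by gcongr
        _ ≤ _ := ih
  refine Summable.of_nonneg_of_le (fun _ => abs_nonneg _) (fun j => ?_)
    ((Real.summable_pow_div_factorial (|z| / c)).mul_left |Real.Gamma α|)
  rw [abs_mul, abs_div, abs_pow, Nat.abs_cast, div_pow]
  calc |z| ^ j / (j.factorial : ℝ) * |Real.Gamma (α - j)|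
      = |Real.Gamma (α - j)| * c ^ j * (|z| ^ j / c ^ j / (j.factorial : ℝ)) := by
        field_simp
    _ ≤ _ := by gcongr; exact hb j

/-- Cut the integral at `t = 1` and turn `(0, 1)` into `(z, ∞)` by `t = z/u`. Expanding in `z` gives
upper incomplete Gamma functions on both pieces. Completing them to full Gamma functions costs two
double series, which are opposite to each other. -/
theorem besselIntegral_eq {α z : ℝ} (hα : ∀ m : ℤ, α ≠ m) (hz : 0 < z) :
    besselIntegral α z = ∑' j : ℕ, (-z) ^ j / (j.factorial : ℝ) * Real.Gamma (α - j) +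
      z ^ α * ∑' j : ℕ, (-z) ^ j / (j.factorial : ℝ) * Real.Gamma (-α - j) := by
  have hα' : ∀ m : ℤ, -α ≠ m := fun m h => hα (-m) (by push_cast; linarith)
  have hΓ : ∀ β : ℝ, (∀ m : ℤ, β ≠ m) → ∀ A : ℝ, 0 < A → ∀ j : ℕ, Real.Gamma (β - j) =
      upperGamma (β - j) A + lowerGammaSeries (β - j) A := fun β hβ A hA j =>
    Gamma_eq_upperGamma_add hA fun m h => hβ (j - m) (by push_cast; linarith)
  have hA := hasSum_setIntegral_besselIntegrand_Ioi α hz.le one_pos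
  have hB := hasSum_setIntegral_besselIntegrand_Ioi (-α) hz.le hz
  have hsplit : besselIntegral α z = (∫ t in Set.Ioi 1, t ^ (α - 1) * Real.exp (-t - z / t)) +
      z ^ α * ∫ t in Set.Ioi z, t ^ (-α - 1) * Real.exp (-t - z / t) := by
    obtain ⟨h1, h2⟩ := integrableOn_and_setIntegral_besselIntegrand_inv α hz one_pos
    rw [div_one] at h2
    rw [← h2, besselIntegral, ← Set.Ioc_union_Ioi_eq_Ioi zero_le_one,
      setIntegral_union Set.Ioc_disjoint_Ioi_same measurableSet_Ioi
      ((integrableOn_Ioc_iff_integrableOn_Ioo).2 h1)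
      (integrableOn_besselIntegrand_Ioi α hz.le one_pos), integral_Ioc_eq_integral_Ioo, add_comm]
  -- The lower incomplete corrections of the two pieces are `D (j, i)` and `-D (i, j)`; absolute
  -- summability permits exchanging the order of summation, after which they cancel.
  let D : ℕ × ℕ → ℝ := fun n => (-z) ^ n.1 / (n.1.factorial : ℝ) *
    ((-1) ^ n.2 / (n.2.factorial : ℝ) * (1 / (α - n.1 + n.2)))
  have hD : Summable D := by
    obtain ⟨c, hc, hcm⟩ := exists_le_abs_sub_int hα
    have h1 : Summable fun n : ℕ × ℕ => (1 / c) * (z ^ n.1 / (n.1.factorial : ℝ) *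
        (1 ^ n.2 / (n.2.factorial : ℝ))) :=
      ((Real.summable_pow_div_factorial z).mul_of_nonneg (Real.summable_pow_div_factorial 1)
        (fun _ => by positivity) (fun _ => by positivity)).mul_left _
    refine h1.of_norm_bounded fun n => ?_
    have h2 : |1 / (α - n.1 + n.2)| ≤ 1 / c := by
      rw [abs_div, abs_one]
      refine one_div_le_one_div_of_le hc ?_
      convert! hcm ((n.1 : ℤ) - n.2) using 2
      push_cast; ring
    simp only [D, norm_mul, norm_div, norm_pow, norm_neg, norm_one, Real.norm_natCast,
      Real.norm_of_nonneg hz.le] at h2 ⊢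
    rw [← Real.norm_eq_abs, norm_div, norm_one] at h2
    calc _ ≤ z ^ n.1 / (n.1.factorial : ℝ) * (1 ^ n.2 / (n.2.factorial : ℝ) * (1 / c)) := by gcongr
      _ = _ := by ring
  have hLA : ∀ j : ℕ, (-z) ^ j / (j.factorial : ℝ) * lowerGammaSeries (α - j) 1 =
      ∑' i, D (j, i) := fun j => by
    rw [lowerGammaSeries, ← tsum_mul_left]
    simp [D]
  have hLB : ∀ j : ℕ, z ^ α * ((-z) ^ j / (j.factorial : ℝ) * lowerGammaSeries (-α - j) z) =
      -∑' i, D (i, j) := fun j => by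
    rw [lowerGammaSeries, ← tsum_mul_left, ← tsum_mul_left, ← tsum_neg]
    refine tsum_congr fun i => ?_
    simp only [D]
    rw [show -α - j + i = -(α - i + j) by ring, div_neg,
      show -(α - i + j) = -α + i - j by ring, Real.rpow_sub_natCast hz.ne',
      Real.rpow_add_natCast hz.ne', Real.rpow_neg hz.le, neg_pow z j, neg_pow z i]
    have := (Real.rpow_pos_of_pos hz α).ne'
    field_simp
  have e1 : ∑' j : ℕ, (-z) ^ j / (j.factorial : ℝ) * Real.Gamma (α - j) =
      (∫ t in Set.Ioi 1, t ^ (α - 1) * Real.exp (-t - z / t)) + ∑' j, ∑' i, D (j, i) := by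
    have := (hA.add hD.prod.hasSum).tsum_eq
    rw [← this]
    refine tsum_congr fun j => ?_
    rw [hΓ α hα 1 one_pos, mul_add, hLA]
  have e2 : z ^ α * ∑' j : ℕ, (-z) ^ j / (j.factorial : ℝ) * Real.Gamma (-α - j) =
      z ^ α * (∫ t in Set.Ioi z, t ^ (-α - 1) * Real.exp (-t - z / t)) -
        ∑' j, ∑' i, D (i, j) := by
    have := ((hB.mul_left (z ^ α)).sub hD.prod_symm.prod.hasSum).tsum_eq
    simp only [Prod.swap_prod_mk] at this
    rw [← this, ← tsum_mul_left]
    refine tsum_congr fun j => ?_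
    rw [hΓ (-α) hα' z hz, mul_add, mul_add, hLB]; ring
  rw [e1, e2, hsplit, Summable.tsum_comm (f := fun j i => D (j, i)) hD]
  ring

/-! ### Evaluation of the quotients of Gamma functions -/

theorem continuousValue_eq {f g : ℝ → ℝ} {a : ℝ} (hg : ContinuousAt g a)
    (h : f =ᶠ[𝓝[≠] a] g) : continuousValue f a = g a :=
  ((hg.tendsto.mono_left nhdsWithin_le_nhds).congr' h.symm).limUnder_eq

theorem firstGammaQuotient_add_right {α : ℝ} (hα : -1 / 2 < α) (n d : ℕ) :
    firstGammaQuotient α n (n + d) =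
      Real.Gamma (((d : ℝ) + 1) / 2 + α) / Real.Gamma ((d : ℝ) / 2 + 1) := by
  have hd : (0 : ℝ) ≤ d := by positivity
  have e : (-(n : ℝ) + (n + d : ℕ)) = d := by push_cast; ring
  unfold firstGammaQuotient
  rw [e]
  refine continuousValue_eq (ContinuousAt.div_const ?_ _) (.refl _ _)
  refine ContinuousAt.comp (f := fun β : ℝ => ((d : ℝ) + 1) / 2 + β)
    (Real.differentiableAt_Gamma fun m h => ?_).continuousAt (by fun_prop)
  have : (0 : ℝ) ≤ m := by positivity
  linarith

theorem firstGammaQuotient_add_odd {α : ℝ} (hα : ∀ m : ℤ, α ≠ m) (n j : ℕ) :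
    firstGammaQuotient α (n + (2 * j + 1)) n = Real.Gamma (α - j) / Real.Gamma (1 / 2 - j) := by
  have e1 : ((-((n + (2 * j + 1) : ℕ) : ℝ) + n + 1) / 2) = -j := by push_cast; ring
  have e2 : ((-((n + (2 * j + 1) : ℕ) : ℝ) + n) / 2 + 1) = 1 / 2 - j := by push_cast; ring
  unfold firstGammaQuotient
  rw [e1, e2, show α - j = -j + α by ring]
  refine continuousValue_eq (ContinuousAt.div_const ?_ _) (.refl _ _)
  refine ContinuousAt.comp (f := fun β : ℝ => -(j : ℝ) + β)
    (Real.differentiableAt_Gamma fun m h => ?_).continuousAt (by fun_prop)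
  exact hα (j - m) (by push_cast; linarith)

theorem firstGammaQuotient_add_even (α : ℝ) (n j : ℕ) :
    firstGammaQuotient α (n + (2 * j + 2)) n = 0 := by
  have e2 : ((-((n + (2 * j + 2) : ℕ) : ℝ) + n) / 2 + 1) = -j := by push_cast; ring
  unfold firstGammaQuotient
  -- `Real.Gamma` is `0` at its poles and division by `0` gives `0`, so the quotient is identically
  -- zero in `β`, as the convention `1/Γ = 0` demands.
  rw [e2, Real.Gamma_neg_nat_eq_zero]
  exact continuousValue_eq (g := fun _ => 0) continuousAt_const (.of_forall fun _ => by simp)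

/-- The `(2j)!` here becomes the `Γ(2j+1)` of the Beta integrals when `firstTerm` is matched with
them. -/
theorem inv_Gamma_half_sub_nat (j : ℕ) :
    (Real.Gamma (1 / 2 - j))⁻¹ =
      (-1) ^ j * ((2 * j).factorial : ℝ) / (2 ^ (2 * j) * (j.factorial : ℝ) * √Real.pi) := by
  induction j with
  | zero => simp [← one_div, Real.Gamma_one_half_eq]
  | succ j ih =>
    have h0 : (1 / 2 : ℝ) - (j + 1 : ℕ) ≠ 0 := by
      have : (0 : ℝ) ≤ j := by positivity
      push_cast; linarith
    have h1 := Real.Gamma_add_one h0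
    rw [show (1 / 2 : ℝ) - (j + 1 : ℕ) + 1 = 1 / 2 - j by push_cast; ring] at h1
    rw [h1, mul_inv] at ih
    rw [← mul_inv_cancel_left₀ h0 (Real.Gamma _)⁻¹, ih,
      show (2 * (j + 1)).factorial = (2 * j + 2) * ((2 * j + 1) * (2 * j).factorial) by
        rw [show 2 * (j + 1) = 2 * j + 1 + 1 by ring, Nat.factorial_succ, Nat.factorial_succ],
      Nat.factorial_succ]
    have h3 : √Real.pi ≠ 0 := by positivity
    push_cast
    field_simp
    ring

theorem Gamma_ne_zero_of_forall_two_mul_ne_int {x : ℝ} (h : ∀ m : ℤ, 2 * x ≠ m) :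
    Real.Gamma x ≠ 0 :=
  Real.Gamma_ne_zero fun m hm => h (-2 * m) (by rw [hm]; push_cast; ring)

/-- The quotient `Γ(-2n₁ - n₂ - 1 - 2β) / Γ(-n₁ + 1/2 - β)` rewritten by the reflection and the
duplication formula. -/
theorem Gamma_div_Gamma_eq {β : ℝ} (h : ∀ m : ℤ, 2 * β ≠ m) (n₁ n₂ : ℕ) :
    Real.Gamma (-2 * (n₁ : ℝ) - n₂ - 1 - 2 * β) / Real.Gamma (-(n₁ : ℝ) + 1 / 2 - β) =
      -((-1) ^ n₂ * Real.Gamma (-β - n₁) * 2 ^ (-(2 * (n₁ : ℝ) + 2 * β)) *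
        Real.Gamma (2 * n₁ + 2 * β + 1)) /
        (2 * √Real.pi * Real.Gamma (2 * n₁ + 2 * β + 1 + (n₂ + 1))) := by
  set p : ℝ := 2 * n₁ + 2 * β + 1 with hp
  have hpi : ∀ m : ℤ, p ≠ m := fun m hm => h (m - 2 * n₁ - 1) (by push_cast; linarith)
  have g1 : Real.Gamma (p + (n₂ + 1)) ≠ 0 :=
    Real.Gamma_ne_zero fun m hm => hpi (-m - n₂ - 1) (by push_cast; linarith)
  have hsin : Real.sin (Real.pi * p) ≠ 0 := by
    rw [mul_comm]
    refine Real.sin_ne_zero_iff.2 fun m hm => hpi m ?_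
    exact (mul_right_cancel₀ Real.pi_ne_zero hm).symm
  -- Reflection at `p` and at `p + n₂ + 1` involves sines equal up to sign, which eliminates them.
  -- Duplication at `-n₁ - β` then splits `Γ(1 - p)` and cancels the denominator of the quotient.
  have r1 := Real.Gamma_mul_Gamma_one_sub p
  have r2 := Real.Gamma_mul_Gamma_one_sub (p + (n₂ + 1))
  have hs : Real.sin (Real.pi * (p + (n₂ + 1))) = -(-1) ^ n₂ * Real.sin (Real.pi * p) := by
    rw [show Real.pi * (p + (n₂ + 1)) = Real.pi * p + ((n₂ + 1 : ℕ) : ℝ) * Real.pi by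
      push_cast; ring, Real.sin_add_nat_mul_pi, pow_succ]
    ring
  have d := Real.Gamma_mul_Gamma_add_half (-n₁ - β)
  have g2 : Real.Gamma (-(n₁ : ℝ) + 1 / 2 - β) ≠ 0 :=
    Gamma_ne_zero_of_forall_two_mul_ne_int fun m hm => h (-m - 2 * n₁ + 1) (by push_cast; linarith)
  rw [show 2 * (-(n₁ : ℝ) - β) = 1 - p by rw [hp]; ring,
    show (1 : ℝ) - (1 - p) = (2 * n₁ + 2 * β) + 1 by rw [hp]; ring,
    show -(n₁ : ℝ) - β + 1 / 2 = -n₁ + 1 / 2 - β by ring,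
    show -(n₁ : ℝ) - β = -β - n₁ by ring] at d
  rw [hs, show 1 - (p + (n₂ + 1)) = -2 * (n₁ : ℝ) - n₂ - 1 - 2 * β by rw [hp]; ring] at r2
  have e : Real.Gamma (p + (n₂ + 1)) * Real.Gamma (-2 * (n₁ : ℝ) - n₂ - 1 - 2 * β) =
      -((-1) ^ n₂ * (Real.Gamma p * Real.Gamma (1 - p))) := by
    rw [r1, r2]
    have : ((-1 : ℝ) ^ n₂) * (-1) ^ n₂ = 1 := by rw [← mul_pow]; simp
    field_simp
    rw [pow_two, this]
  have hpi0 : √Real.pi ≠ 0 := by positivity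
  have hq : (2 : ℝ) ^ (-(2 * (n₁ : ℝ) + 2 * β)) * 2 ^ (2 * (n₁ : ℝ) + 2 * β + 1) = 2 := by
    rw [← Real.rpow_add two_pos,
      show -(2 * (n₁ : ℝ) + 2 * β) + (2 * (n₁ : ℝ) + 2 * β + 1) = 1 by ring, Real.rpow_one]
  rw [div_eq_div_iff g2 (by positivity)]
  linear_combination (2 * √Real.pi) * e
    + ((-1) ^ n₂ * 2 ^ (-(2 * (n₁ : ℝ) + 2 * β)) * Real.Gamma p) * d
    + ((-1) ^ n₂ * Real.Gamma p * Real.Gamma (1 - p) * √Real.pi) * hq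

/-- The rewritten quotient stays continuous at `α` even when `2α` is an integer: its only factor
that could meet a pole is `Γ(-β - n₁)`, and `α` is not an integer. It thus computes the limit. -/
theorem secondGammaQuotient_eq {α : ℝ} (hα : -1 / 2 < α) (hαZ : ∀ m : ℤ, α ≠ m) (n₁ n₂ : ℕ) :
    secondGammaQuotient α n₁ n₂ =
      -((-1) ^ n₂ * Real.Gamma (-α - n₁) * 2 ^ (-(2 * (n₁ : ℝ) + 2 * α)) *
        Real.Gamma (2 * n₁ + 2 * α + 1)) /
        (2 * √Real.pi * Real.Gamma (2 * n₁ + 2 * α + 1 + (n₂ + 1))) := by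
  have hn₁ : (0 : ℝ) ≤ n₁ := by positivity
  have hn₂ : (0 : ℝ) ≤ n₂ := by positivity
  have hG : ∀ {f : ℝ → ℝ}, ContinuousAt f α → (∀ m : ℕ, f α ≠ -m) →
      ContinuousAt (fun β => Real.Gamma (f β)) α := fun hf hm =>
    (Real.differentiableAt_Gamma hm).continuousAt.comp hf
  have hpos : ∀ {x : ℝ}, 0 < x → ∀ m : ℕ, x ≠ -m := fun hx m h => by
    have : (0 : ℝ) ≤ m := by positivity
    linarith
  unfold secondGammaQuotient
  refine continuousValue_eq (g := fun β => -((-1) ^ n₂ * Real.Gamma (-β - n₁) *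
    2 ^ (-(2 * (n₁ : ℝ) + 2 * β)) * Real.Gamma (2 * n₁ + 2 * β + 1)) /
        (2 * √Real.pi * Real.Gamma (2 * n₁ + 2 * β + 1 + (n₂ + 1)))) ?_ ?_
  · refine ContinuousAt.div (ContinuousAt.neg (ContinuousAt.mul (ContinuousAt.mul
      (continuousAt_const.mul (hG (by fun_prop) fun m hm => hαZ (m - n₁) (by push_cast; linarith)))
      (Continuous.continuousAt ?_)) (hG (by fun_prop) (hpos (by linarith)))))
      (continuousAt_const.mul (hG (by fun_prop) (hpos (by linarith)))) ?_
    · exact Real.continuous_const_rpow two_ne_zero |>.comp (by fun_prop)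
    · have := Real.Gamma_pos_of_pos (show 0 < 2 * (n₁ : ℝ) + 2 * α + 1 + (n₂ + 1) by linarith)
      positivity
  · have h : ∀ᶠ β : ℝ in 𝓝[≠] α, ∀ m : ℤ, 2 * β ≠ m := by
      have hc : Tendsto (fun β : ℝ => 2 * β) (𝓝[≠] α) (𝓝 (2 * α)) :=
        (Continuous.tendsto (by fun_prop) α).mono_left nhdsWithin_le_nhds
      have h1 := hc.eventually_lt_const (Int.lt_floor_add_one (2 * α))
      have h2 := hc.eventually_const_lt (sub_one_lt (⌊2 * α⌋ : ℝ) |>.trans_le (Int.floor_le _))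
      have h3 : ∀ᶠ β : ℝ in 𝓝[≠] α, 2 * β ≠ ⌊2 * α⌋ := by
        -- Near `α`, `2β` lies strictly between `⌊2α⌋ - 1` and `⌊2α⌋ + 1`, so `⌊2α⌋` is the only
        -- integer to avoid; if `2α` equals it, puncturing the neighbourhood suffices.
        by_cases h : 2 * α = ⌊2 * α⌋
        · filter_upwards [self_mem_nhdsWithin] with β hβ h'
          exact hβ (mul_left_cancel₀ two_ne_zero (h'.trans h.symm))
        · exact hc.eventually_ne h
      filter_upwards [h1, h2, h3] with β h1 h2 h3 m hm
      rw [hm] at h1 h2 h3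
      norm_cast at h1 h2 h3
      omega
    filter_upwards [h] with β hβ
    exact Gamma_div_Gamma_eq hβ n₁ n₂

/-! ### The Lebesgue density of the Variance Gamma law -/

theorem integrableOn_besselIntegrand (β : ℝ) {z : ℝ} (hz : 0 < z) :
    IntegrableOn (fun t : ℝ => t ^ (β - 1) * Real.exp (-t - z / t)) (Set.Ioi 0) := by
  rw [← Set.Ioc_union_Ioi_eq_Ioi zero_le_one]
  exact ((integrableOn_Ioc_iff_integrableOn_Ioo).2
    (integrableOn_and_setIntegral_besselIntegrand_inv β hz one_pos).1).union
    (integrableOn_besselIntegrand_Ioi β hz.le one_pos)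

theorem besselIntegral_nonneg (β z : ℝ) : 0 ≤ besselIntegral β z :=
  setIntegral_nonneg measurableSet_Ioi fun t ht => by
    have : (0 : ℝ) < t := ht
    positivity

theorem measurable_besselIntegral (β : ℝ) : Measurable (besselIntegral β) := by
  have h : Measurable (Function.uncurry fun z t : ℝ => t ^ (β - 1) * Real.exp (-t - z / t)) := by
    simp only [Function.uncurry_def]
    fun_prop
  exact (h.stronglyMeasurable.integral_prod_right' (ν := volume.restrict (Set.Ioi 0))).measurable

/-- The Lebesgue density of the symmetric Variance Gamma law with shape `α + 1/2` and re-scaled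
volatility `s`. -/
noncomputable def vgDensity (α s x : ℝ) : ℝ :=
  besselIntegral α ((x / (2 * s)) ^ 2) / (2 * s * √Real.pi * Real.Gamma (α + 1 / 2))

theorem vgDensity_nonneg {α s : ℝ} (hα : -1 / 2 < α) (hs : 0 < s) (x : ℝ) :
    0 ≤ vgDensity α s x := by
  have := Real.Gamma_pos_of_pos (show 0 < α + 1 / 2 by linarith)
  have := besselIntegral_nonneg α ((x / (2 * s)) ^ 2)
  unfold vgDensity
  positivity

@[fun_prop]
theorem measurable_vgDensity (α s : ℝ) : Measurable (vgDensity α s) :=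
  ((measurable_besselIntegral α).comp (by fun_prop)).div_const _

theorem rescaledVol_pos {σ ν : ℝ} (hσ : 0 < σ) (hν : 0 < ν) : 0 < rescaledVol σ ν := by
  unfold rescaledVol; positivity

/-- With `t = y/ν` the product is the Bessel integrand at `z = (x/(2s))²`; the Gaussian
normalisation `y^(-1/2)` lowers the exponent from `τ/ν` to `α = τ/ν - 1/2`. -/
theorem gammaPDFReal_mul_gaussianPDFReal {σ ν τ x y : ℝ} (hσ : 0 < σ) (hν : 0 < ν) (hy : 0 < y) :
    gammaPDFReal (τ / ν) (1 / ν) y * gaussianPDFReal (0 * y) (σ ^ 2 * y).toNNReal x =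
      (2 * rescaledVol σ ν * √Real.pi * Real.Gamma (τ / ν))⁻¹ * (ν⁻¹ *
        ((ν⁻¹ * y) ^ (τ / ν - 1 / 2 - 1) *
          Real.exp (-(ν⁻¹ * y) - (x / (2 * rescaledVol σ ν)) ^ 2 / (ν⁻¹ * y)))) := by
  have hs := rescaledVol_pos hσ hν
  have hs2 : rescaledVol σ ν ^ 2 = σ ^ 2 * ν / 2 := by
    rw [rescaledVol, mul_pow, Real.sq_sqrt (by positivity)]; ring
  have h1 : √(2 * Real.pi * (σ ^ 2 * y)) =
      2 * rescaledVol σ ν * √Real.pi * (ν⁻¹ * y) ^ (1 / 2 : ℝ) := by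
    rw [← Real.sqrt_eq_rpow, Real.sqrt_eq_iff_mul_self_eq (by positivity) (by positivity)]
    have e1 := Real.mul_self_sqrt Real.pi_pos.le
    have e2 := Real.mul_self_sqrt (show 0 ≤ ν⁻¹ * y by positivity)
    symm
    calc _ = 4 * rescaledVol σ ν ^ 2 * (√Real.pi * √Real.pi) * (√(ν⁻¹ * y) * √(ν⁻¹ * y)) := by ring
      _ = _ := by rw [e1, e2, hs2]; field_simp; ring
  have h2 : -(x - 0 * y) ^ 2 / (2 * (σ ^ 2 * y)) =
      -((x / (2 * rescaledVol σ ν)) ^ 2 / (ν⁻¹ * y)) := by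
    rw [div_pow, mul_pow, hs2]; field_simp; ring
  have ht : 0 < ν⁻¹ * y := by positivity
  have h3 : (1 / ν) ^ (τ / ν) * y ^ (τ / ν - 1) = ν⁻¹ * (ν⁻¹ * y) ^ (τ / ν - 1) := by
    rw [Real.mul_rpow (by positivity) hy.le, Real.rpow_sub_one (x := ν⁻¹) (by positivity), one_div]
    field_simp
  rw [gammaPDFReal, if_pos hy.le, gaussianPDFReal, Real.coe_toNNReal _ (by positivity), h1, h2,
    show τ / ν - 1 / 2 - 1 = τ / ν - 1 - 1 / 2 by ring, Real.rpow_sub ht, sub_eq_add_neg (-_),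
    Real.exp_add, one_div_mul_eq_div]
  have : 0 < (ν⁻¹ * y) ^ (1 / 2 : ℝ) := by positivity
  calc _ = ((1 / ν) ^ (τ / ν) * y ^ (τ / ν - 1)) / Real.Gamma (τ / ν) * Real.exp (-(y / ν)) *
        ((2 * rescaledVol σ ν * √Real.pi * (ν⁻¹ * y) ^ (1 / 2 : ℝ))⁻¹ *
        Real.exp (-((x / (2 * rescaledVol σ ν)) ^ 2 / (ν⁻¹ * y)))) := by ring
    _ = _ := by rw [h3, mul_inv, mul_inv _ (Real.Gamma _), inv_mul_eq_div ν y]; ring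

/-- For `x ≠ 0` the factor `e^(-z/t)` secures integrability at `t = 0`, which may fail at `x = 0`
when `α ≤ 0`. -/
theorem lintegral_gammaPDF_mul_gaussianPDF {σ ν τ x : ℝ} (hσ : 0 < σ) (hν : 0 < ν) (hτ : 0 < τ)
    (hx : x ≠ 0) :
    ∫⁻ y, gammaPDF (τ / ν) (1 / ν) y * gaussianPDF (0 * y) (σ ^ 2 * y).toNNReal x =
      ENNReal.ofReal (vgDensity (τ / ν - 1 / 2) (rescaledVol σ ν) x) := by
  have hs := rescaledVol_pos hσ hν
  have hΓ := Real.Gamma_pos_of_pos (show 0 < τ / ν by positivity)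
  have hz : 0 < (x / (2 * rescaledVol σ ν)) ^ 2 := by positivity
  have hI := integrableOn_besselIntegrand (τ / ν - 1 / 2) hz
  have hsub := integral_comp_mul_left_Ioi (fun t : ℝ => t ^ (τ / ν - 1 / 2 - 1) *
    Real.exp (-t - (x / (2 * rescaledVol σ ν)) ^ 2 / t)) 0 (show 0 < ν⁻¹ by positivity)
  have hI' := (integrableOn_Ioi_comp_mul_left_iff (fun t : ℝ => t ^ (τ / ν - 1 / 2 - 1) *
    Real.exp (-t - (x / (2 * rescaledVol σ ν)) ^ 2 / t)) 0 (show 0 < ν⁻¹ by positivity)).2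
    (by rwa [mul_zero])
  have h0 : ∫⁻ y, gammaPDF (τ / ν) (1 / ν) y * gaussianPDF (0 * y) (σ ^ 2 * y).toNNReal x =
      ∫⁻ y in Set.Ioi 0, gammaPDF (τ / ν) (1 / ν) y *
        gaussianPDF (0 * y) (σ ^ 2 * y).toNNReal x := by
    rw [← lintegral_indicator measurableSet_Ioi]
    refine lintegral_congr fun y => ?_
    by_cases hy : 0 < y
    · simp [hy]
    · have : (σ ^ 2 * y).toNNReal = 0 :=
        Real.toNNReal_of_nonpos (mul_nonpos_of_nonneg_of_nonpos (by positivity) (not_lt.1 hy))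
      simp [hy, this]
  rw [h0, vgDensity, besselIntegral]
  rw [mul_zero, inv_inv, smul_eq_mul, ← inv_mul_eq_iff_eq_mul₀ hν.ne', ← integral_const_mul] at hsub
  rw [← hsub, div_eq_inv_mul _ (2 * rescaledVol σ ν * √Real.pi * _), sub_add_cancel,
    ← integral_const_mul, ofReal_integral_eq_lintegral_ofReal
    ((hI'.const_mul _).const_mul _)]
  · refine setLIntegral_congr_fun measurableSet_Ioi fun y hy => ?_
    rw [← gammaPDFReal_mul_gaussianPDFReal hσ hν hy, gammaPDF, gaussianPDF, ENNReal.ofReal_mul]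
    exact gammaPDFReal_nonneg (by positivity) (by positivity) _
  · refine (ae_restrict_iff' measurableSet_Ioi).2 (.of_forall fun y hy => ?_)
    have : (0 : ℝ) < y := hy
    simp only [Pi.zero_apply]
    positivity

theorem measurable_gaussianReal_zero_mul (σ : ℝ) :
    Measurable fun y : ℝ => gaussianReal (0 * y) (σ ^ 2 * y).toNNReal :=
  measurable_gaussianReal.comp (by fun_prop : Measurable fun y : ℝ => (0 * y, (σ ^ 2 * y).toNNReal))

theorem vgLaw_eq_withDensity {σ ν τ : ℝ} (hσ : 0 < σ) (hν : 0 < ν) (hτ : 0 < τ) :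
    vgLaw σ ν 0 τ = volume.withDensity fun x =>
      ENNReal.ofReal (vgDensity (τ / ν - 1 / 2) (rescaledVol σ ν) x) := by
  have hm := measurable_gaussianReal_zero_mul σ
  have hmp : Measurable (Function.uncurry fun y x : ℝ => gammaPDF (τ / ν) (1 / ν) y *
      gaussianPDF (0 * y) (σ ^ 2 * y).toNNReal x) := by
    simp only [Function.uncurry_def]
    refine Measurable.mul (M := ENNReal) ?_ ?_
    · exact (measurable_gammaPDFReal _ _).ennreal_ofReal.comp measurable_fst
    · exact measurable_uncurry_gaussianPDF.comp (by fun_prop :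
        Measurable fun p : ℝ × ℝ => (0 * p.1, (σ ^ 2 * p.1).toNNReal, p.2))
  ext B hB
  have hg : Measurable (gammaPDF (τ / ν) (1 / ν)) := (measurable_gammaPDFReal _ _).ennreal_ofReal
  have hB' : Measurable fun y : ℝ => gaussianReal (0 * y) (σ ^ 2 * y).toNNReal B :=
    (Measure.measurable_coe hB).comp hm
  rw [vgLaw, Measure.bind_apply hB hm.aemeasurable, withDensity_apply _ hB, gammaMeasure,
    lintegral_withDensity_eq_lintegral_mul _ hg hB']
  -- Two null sets are discarded: `y = 0`, where the Gaussian is a Dirac mass without density, and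
  -- `x = 0`, where the Bessel integral may diverge.
  have hne : ∀ c : ℝ, ∀ᵐ y : ℝ, y ≠ c := fun c => by simp [ae_iff]
  have e : ∀ᵐ y : ℝ, (gammaPDF (τ / ν) (1 / ν) * fun y => gaussianReal (0 * y)
      (σ ^ 2 * y).toNNReal B) y = ∫⁻ x in B, gammaPDF (τ / ν) (1 / ν) y *
        gaussianPDF (0 * y) (σ ^ 2 * y).toNNReal x := by
    filter_upwards [hne 0] with y hy
    rcases hy.lt_or_gt with hy | hy
    · simp [gammaPDF_of_neg hy]
    · have : (σ ^ 2 * y).toNNReal ≠ 0 := by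
        rw [Ne, Real.toNNReal_eq_zero, not_le]; positivity
      rw [Pi.mul_apply, gaussianReal_apply _ this, lintegral_const_mul _ (measurable_gaussianPDF _ _)]
  rw [lintegral_congr_ae e, lintegral_lintegral_swap hmp.aemeasurable]
  refine lintegral_congr_ae (ae_restrict_of_ae ?_)
  filter_upwards [hne 0] with x hx
  exact lintegral_gammaPDF_mul_gaussianPDF hσ hν hτ hx

/-! ### Half-line moments of the density -/

theorem integral_pow_mul_exp_neg_sq_div (d : ℕ) {t : ℝ} (ht : 0 < t) :
    IntegrableOn (fun w : ℝ => w ^ d * Real.exp (-(w ^ 2 / t))) (Set.Ioi 0) ∧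
    ∫ w in Set.Ioi 0, w ^ d * Real.exp (-(w ^ 2 / t)) =
      t ^ (((d : ℝ) + 1) / 2) * (Real.Gamma (((d : ℝ) + 1) / 2) / 2) := by
  have hd : (0 : ℝ) ≤ d := by positivity
  have h := integral_rpow_mul_exp_neg_mul_rpow (p := 2) (q := d) (b := t⁻¹) two_pos
    (by linarith) (by positivity)
  have e : ∀ w : ℝ, w ^ (d : ℝ) * Real.exp (-t⁻¹ * w ^ (2 : ℝ)) =
      w ^ d * Real.exp (-(w ^ 2 / t)) := fun w => by
    rw [Real.rpow_natCast, Real.rpow_two]; ring_nf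
  simp only [e] at h
  rw [neg_div, Real.inv_rpow ht.le, Real.rpow_neg ht.le, inv_inv] at h
  have h' : ∫ w in Set.Ioi 0, w ^ d * Real.exp (-(w ^ 2 / t)) =
      t ^ (((d : ℝ) + 1) / 2) * (Real.Gamma (((d : ℝ) + 1) / 2) / 2) := by rw [h]; ring
  -- The Bochner integral of a non-integrable function is `0`, so a nonzero value proves
  -- integrability.
  refine ⟨.of_integral_ne_zero ?_, h'⟩
  have := Real.Gamma_pos_of_pos (show 0 < ((d : ℝ) + 1) / 2 by positivity)
  rw [h']
  positivity

/-- By Tonelli, the `w`-integral is a Gaussian moment proportional to `t^((d+1)/2)`, and the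
remaining `t`-integral is a Gamma integral. -/
theorem lintegral_pow_mul_besselIntegral_sq {α : ℝ} (hα : -1 / 2 < α) (d : ℕ) :
    ∫⁻ w in Set.Ioi 0, ENNReal.ofReal (w ^ d * besselIntegral α (w ^ 2)) =
      ENNReal.ofReal (Real.Gamma (((d : ℝ) + 1) / 2 + α) * (Real.Gamma (((d : ℝ) + 1) / 2) / 2)) := by
  have hd : (0 : ℝ) ≤ d := by positivity
  have hm : Measurable (Function.uncurry fun w t : ℝ =>
      ENNReal.ofReal (w ^ d * (t ^ (α - 1) * Real.exp (-t - w ^ 2 / t)))) := by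
    simp only [Function.uncurry_def]
    fun_prop
  have h1 : ∀ w ∈ Set.Ioi (0 : ℝ), ENNReal.ofReal (w ^ d * besselIntegral α (w ^ 2)) =
      ∫⁻ t in Set.Ioi 0, ENNReal.ofReal (w ^ d * (t ^ (α - 1) * Real.exp (-t - w ^ 2 / t))) := by
    intro w hw
    have hw : 0 < w := hw
    rw [besselIntegral, ← integral_const_mul, ofReal_integral_eq_lintegral_ofReal
      ((integrableOn_besselIntegrand α (by positivity)).const_mul _)]
    refine (ae_restrict_iff' measurableSet_Ioi).2 (.of_forall fun t ht => ?_)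
    have : (0 : ℝ) < t := ht
    simp only [Pi.zero_apply]
    positivity
  have hΓ := Real.Gamma_pos_of_pos (show 0 < ((d : ℝ) + 1) / 2 by positivity)
  have h2 : ∀ t ∈ Set.Ioi (0 : ℝ),
      ∫⁻ w in Set.Ioi 0, ENNReal.ofReal (w ^ d * (t ^ (α - 1) * Real.exp (-t - w ^ 2 / t))) =
        ENNReal.ofReal (Real.exp (-t) * t ^ (((d : ℝ) + 1) / 2 + α - 1) *
          (Real.Gamma (((d : ℝ) + 1) / 2) / 2)) := by
    intro t ht
    have ht : 0 < t := ht
    obtain ⟨hi, hv⟩ := integral_pow_mul_exp_neg_sq_div d ht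
    rw [show Real.exp (-t) * t ^ (((d : ℝ) + 1) / 2 + α - 1) * (Real.Gamma (((d : ℝ) + 1) / 2) / 2)
      = t ^ (α - 1) * Real.exp (-t) * (t ^ (((d : ℝ) + 1) / 2) * (Real.Gamma (((d : ℝ) + 1) / 2) / 2))
      by rw [add_sub_assoc, Real.rpow_add ht]; ring, ← hv, ← integral_const_mul,
      ofReal_integral_eq_lintegral_ofReal (hi.const_mul _)]
    · refine setLIntegral_congr_fun measurableSet_Ioi fun w hw => ?_
      rw [sub_eq_add_neg (-t), Real.exp_add]
      congr 1; ring
    · refine (ae_restrict_iff' measurableSet_Ioi).2 (.of_forall fun w hw => ?_)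
      have : (0 : ℝ) < w := hw
      simp only [Pi.zero_apply]
      positivity
  have hp : 0 < ((d : ℝ) + 1) / 2 + α := by linarith
  rw [setLIntegral_congr_fun measurableSet_Ioi h1, lintegral_lintegral_swap hm.aemeasurable,
    setLIntegral_congr_fun measurableSet_Ioi h2, Real.Gamma_eq_integral hp, ← integral_mul_const,
    ofReal_integral_eq_lintegral_ofReal ((Real.GammaIntegral_convergent hp).mul_const _)]
  refine (ae_restrict_iff' measurableSet_Ioi).2 (.of_forall fun w hw => ?_)
  have : (0 : ℝ) < w := hw
  simp only [Pi.zero_apply]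
  positivity

theorem integral_pow_mul_besselIntegral_sq {α : ℝ} (hα : -1 / 2 < α) (d : ℕ) :
    ∫ w in Set.Ioi 0, w ^ d * besselIntegral α (w ^ 2) =
      Real.Gamma (((d : ℝ) + 1) / 2 + α) * (Real.Gamma (((d : ℝ) + 1) / 2) / 2) := by
  have hd : (0 : ℝ) ≤ d := by positivity
  have h1 := Real.Gamma_pos_of_pos (show 0 < ((d : ℝ) + 1) / 2 by positivity)
  have h2 := Real.Gamma_pos_of_pos (show 0 < ((d : ℝ) + 1) / 2 + α by linarith)
  rw [integral_eq_lintegral_of_nonneg_ae, lintegral_pow_mul_besselIntegral_sq hα,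
    ENNReal.toReal_ofReal (by positivity)]
  · refine (ae_restrict_iff' measurableSet_Ioi).2 (.of_forall fun w hw => ?_)
    have : (0 : ℝ) < w := hw
    exact mul_nonneg (by positivity) (besselIntegral_nonneg _ _)
  · exact (Measurable.mul (by fun_prop)
      ((measurable_besselIntegral α).comp (by fun_prop))).aestronglyMeasurable

/-- The half-line moments of the symmetric Variance Gamma law. -/
theorem integral_pow_mul_vgDensity {α s : ℝ} (hα : -1 / 2 < α) (hs : 0 < s) (d : ℕ) :
    ∫ x in Set.Ioi 0, x ^ d / (d.factorial : ℝ) * vgDensity α s x =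
      s ^ d * (Real.Gamma (((d : ℝ) + 1) / 2 + α) / Real.Gamma ((d : ℝ) / 2 + 1)) /
        (2 * Real.Gamma (α + 1 / 2)) := by
  have h := integral_comp_mul_left_Ioi (fun w => w ^ d * besselIntegral α (w ^ 2)) 0
    (show 0 < (2 * s)⁻¹ by positivity)
  rw [mul_zero, integral_pow_mul_besselIntegral_sq hα, inv_inv, smul_eq_mul] at h
  have e : ∀ x, x ^ d / (d.factorial : ℝ) * vgDensity α s x =
      (2 * s) ^ d / ((d.factorial : ℝ) * (2 * s * √Real.pi * Real.Gamma (α + 1 / 2))) *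
        (((2 * s)⁻¹ * x) ^ d * besselIntegral α (((2 * s)⁻¹ * x) ^ 2)) := fun x => by
    rw [vgDensity, mul_pow (2 * s)⁻¹ x d, div_eq_inv_mul x, inv_pow]
    have : (2 * s) ^ d ≠ 0 := by positivity
    field_simp
  simp only [e]
  rw [integral_const_mul, h]
  -- Duplication writes `d!` through `Γ((d+1)/2) Γ(d/2+1)`; the first factor cancels the one from
  -- the Gaussian moment.
  have hdup := Real.Gamma_mul_Gamma_add_half (((d : ℝ) + 1) / 2)
  rw [show 2 * (((d : ℝ) + 1) / 2) = d + 1 by ring, Real.Gamma_nat_eq_factorial,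
    show ((d : ℝ) + 1) / 2 + 1 / 2 = d / 2 + 1 by ring, show 1 - ((d : ℝ) + 1) = -d by ring,
    Real.rpow_neg two_pos.le, Real.rpow_natCast] at hdup
  have h1 := Real.Gamma_pos_of_pos (show 0 < (d : ℝ) / 2 + 1 by positivity)
  have h2 := Real.Gamma_pos_of_pos (show 0 < α + 1 / 2 by linarith)
  have h3 : 0 < √Real.pi := by positivity
  rw [← eq_div_iff h1.ne'] at hdup
  rw [hdup, mul_pow]
  field_simp

/-! ### Exponential integrability and transfer to the density -/

/-- Given the Gamma time `y`, the expectation of `e^x` is `e^(σ²y/2)`; against a Gamma law of rate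
`1/ν` this is integrable because `σ²/2 < 1/ν`. -/
theorem integrable_exp_vgLaw {σ ν τ : ℝ} (hν : 0 < ν) (hτ : 0 < τ) (hσν : σ ^ 2 * ν < 2) :
    Integrable Real.exp (vgLaw σ ν 0 τ) := by
  refine ⟨Real.measurable_exp.aestronglyMeasurable, ?_⟩
  rw [hasFiniteIntegral_iff_ofReal (.of_forall fun x => (Real.exp_pos x).le), vgLaw,
    Measure.lintegral_bind (measurable_gaussianReal_zero_mul σ).aemeasurable (by fun_prop)]
  have h1 : ∀ y : ℝ, ∫⁻ x, ENNReal.ofReal (Real.exp x) ∂gaussianReal (0 * y) (σ ^ 2 * y).toNNReal =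
      ENNReal.ofReal (Real.exp ((σ ^ 2 * y).toNNReal / 2)) := fun y => by
    have hi := integrable_exp_mul_gaussianReal (μ := 0 * y) (v := (σ ^ 2 * y).toNNReal) 1
    have hm := congrFun (mgf_id_gaussianReal (μ := 0 * y) (v := (σ ^ 2 * y).toNNReal)) 1
    simp only [one_mul] at hi
    rw [← ofReal_integral_eq_lintegral_ofReal hi (.of_forall fun x => (Real.exp_pos x).le)]
    simpa [mgf] using congrArg ENNReal.ofReal hm
  have hg : Measurable (gammaPDF (τ / ν) (1 / ν)) := (measurable_gammaPDFReal _ _).ennreal_ofReal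
  simp only [h1]
  rw [gammaMeasure, lintegral_withDensity_eq_lintegral_mul _ hg (by fun_prop)]
  have hr : 0 < 1 / ν - σ ^ 2 / 2 := by
    rw [sub_pos, lt_div_iff₀ hν]; linarith
  have hint : IntegrableOn (fun t : ℝ => t ^ (τ / ν - 1) * Real.exp (-((1 / ν - σ ^ 2 / 2) * t)))
      (Set.Ioi 0) := by
    refine .of_integral_ne_zero ?_
    rw [Real.integral_rpow_mul_exp_neg_mul_Ioi (by positivity) hr]
    have := Real.Gamma_pos_of_pos (show 0 < τ / ν by positivity)
    positivity
  have h2 : ∫⁻ y, (gammaPDF (τ / ν) (1 / ν) * fun y : ℝ =>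
      ENNReal.ofReal (Real.exp ((σ ^ 2 * y).toNNReal / 2))) y =
      ∫⁻ y in Set.Ioi 0, ENNReal.ofReal ((1 / ν) ^ (τ / ν) / Real.Gamma (τ / ν) *
        (y ^ (τ / ν - 1) * Real.exp (-((1 / ν - σ ^ 2 / 2) * y)))) := by
    rw [← lintegral_indicator measurableSet_Ioi]
    refine lintegral_congr_ae ?_
    have hne : ∀ᵐ y : ℝ, y ≠ 0 := by simp [ae_iff]
    filter_upwards [hne] with y hy
    rcases hy.lt_or_gt with hy | hy
    · simp [gammaPDF_of_neg hy, hy.le]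
    · rw [Set.indicator_of_mem (Set.mem_Ioi.2 hy), Pi.mul_apply, gammaPDF, ← ENNReal.ofReal_mul
        (gammaPDFReal_nonneg (by positivity) (by positivity) _), gammaPDFReal, if_pos hy.le,
        Real.coe_toNNReal _ (by positivity), mul_assoc, mul_assoc, ← Real.exp_add]
      congr 4; ring
  rw [h2]
  exact (hint.const_mul _).lintegral_lt_top

theorem neg_half_lt_div_sub_half {ν τ : ℝ} (hν : 0 < ν) (hτ : 0 < τ) : -1 / 2 < τ / ν - 1 / 2 := by
  have : 0 < τ / ν := by positivity
  linarith

theorem integrable_vgLaw_iff {σ ν τ : ℝ} (hσ : 0 < σ) (hν : 0 < ν) (hτ : 0 < τ) {g : ℝ → ℝ} :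
    Integrable g (vgLaw σ ν 0 τ) ↔
      Integrable fun x => vgDensity (τ / ν - 1 / 2) (rescaledVol σ ν) x * g x := by
  have h0 := fun x => vgDensity_nonneg (neg_half_lt_div_sub_half hν hτ) (rescaledVol_pos hσ hν) x
  rw [vgLaw_eq_withDensity hσ hν hτ, integrable_withDensity_iff_integrable_smul' (by fun_prop)
    (by simp)]
  simp only [ENNReal.toReal_ofReal (h0 _), smul_eq_mul]

theorem integral_vgLaw {σ ν τ : ℝ} (hσ : 0 < σ) (hν : 0 < ν) (hτ : 0 < τ) (g : ℝ → ℝ) :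
    ∫ x, g x ∂vgLaw σ ν 0 τ =
      ∫ x, vgDensity (τ / ν - 1 / 2) (rescaledVol σ ν) x * g x := by
  have h0 := fun x => vgDensity_nonneg (neg_half_lt_div_sub_half hν hτ) (rescaledVol_pos hσ hν) x
  rw [vgLaw_eq_withDensity hσ hν hτ, integral_withDensity_eq_integral_toReal_smul (by fun_prop)
    (by simp)]
  simp only [ENNReal.toReal_ofReal (h0 _), smul_eq_mul]

/-! ### Termwise integration over `(0, κ]` -/

theorem hasSum_pnat_pow_div_factorial (x : ℝ) :
    HasSum (fun i : ℕ+ => x ^ (i : ℕ) / ((i : ℕ).factorial : ℝ)) (Real.exp x - 1) := by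
  have h := (hasSum_nat_add_iff' 1).2 (hasSum_pow_div_factorial_exp x)
  rw [← Equiv.pnatEquivNat.hasSum_iff] at h
  simp only [Finset.range_one, Finset.sum_singleton, pow_zero, Nat.factorial_zero, Nat.cast_one,
    div_one] at h
  convert! h using 2 with i
  simp

theorem integrableOn_rpow_mul_sub_pow {p κ : ℝ} (hp : -1 < p) (hκ : 0 ≤ κ) (n : ℕ) :
    IntegrableOn (fun x : ℝ => x ^ p * (x - κ) ^ n) (Set.Ioc 0 κ) := by
  rw [← intervalIntegrable_iff_integrableOn_Ioc_of_le hκ]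
  exact (intervalIntegral.intervalIntegrable_rpow' hp).mul_continuousOn (by fun_prop)

/-- A rescaled Beta integral. Splitting one factor `x - κ` in the induction raises `p`, hence the
generalisation over `p`. -/
theorem setIntegral_rpow_mul_sub_pow {p κ : ℝ} (hp : -1 < p) (hκ : 0 < κ) (n : ℕ) :
    ∫ x in Set.Ioc 0 κ, x ^ p * (x - κ) ^ n = (-1) ^ n * (n.factorial : ℝ) * κ ^ (p + 1 + n) *
      Real.Gamma (p + 1) / Real.Gamma (p + 1 + (n + 1)) := by
  induction n generalizing p with
  | zero =>
    have h1 := Real.Gamma_pos_of_pos (show 0 < p + 1 by linarith)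
    simp only [pow_zero, mul_one, Nat.factorial_zero, Nat.cast_one, Nat.cast_zero, add_zero,
      zero_add, one_mul]
    rw [← intervalIntegral.integral_of_le hκ.le, integral_rpow (Or.inl hp),
      Real.zero_rpow (by linarith), Real.Gamma_add_one (show p + 1 ≠ 0 by linarith)]
    field_simp
    simp
  | succ n ih =>
    have hn : (0 : ℝ) ≤ n := by positivity
    have e : ∀ x ∈ Set.Ioc 0 κ, x ^ p * (x - κ) ^ (n + 1) =
        x ^ (p + 1) * (x - κ) ^ n - κ * (x ^ p * (x - κ) ^ n) := fun x hx => by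
      rw [Real.rpow_add_one hx.1.ne']; ring
    rw [setIntegral_congr_fun measurableSet_Ioc e, integral_sub
      (integrableOn_rpow_mul_sub_pow (by linarith) hκ.le n)
      ((integrableOn_rpow_mul_sub_pow hp hκ.le n).const_mul _), integral_const_mul, ih hp,
      ih (by linarith)]
    have h1 := Real.Gamma_pos_of_pos (show 0 < p + 1 + (n + 1) by linarith)
    have h2 := Real.Gamma_add_one (show p + 1 + ((n : ℝ) + 1) ≠ 0 by linarith)
    push_cast
    rw [show p + 1 + 1 + ((n : ℝ) + 1) = p + 1 + (n + 1) + 1 by ring,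
      show p + 1 + ((n : ℝ) + 1 + 1) = p + 1 + (n + 1) + 1 by ring,
      h2, Real.Gamma_add_one (show p + 1 ≠ 0 by linarith), Nat.factorial_succ,
      show p + 1 + 1 + (n : ℝ) = p + 1 + n + 1 by ring, ← add_assoc (p + 1) (n : ℝ) 1,
      Real.rpow_add_one hκ.ne']
    have h3 : p + 1 + (n : ℝ) + 1 ≠ 0 := by linarith
    rw [← add_assoc] at h1
    push_cast
    field_simp
    ring

/-- Termwise integration of a generalized power series `g x = ∑ u_j x^(2j+e)` against
`e^(x-κ) - 1` over `(0, κ]`. -/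
theorem hasSum_setIntegral_exp_sub_one_mul {u : ℕ → ℝ} {g : ℝ → ℝ} {κ e : ℝ} (hκ : 0 < κ)
    (he : -1 < e) (hu : Summable fun j => |u j * κ ^ (2 * j)|)
    (hg : ∀ x ∈ Set.Ioc 0 κ, HasSum (fun j => u j * x ^ (2 * j + e)) (g x)) :
    IntegrableOn (fun x => g x * (Real.exp (x - κ) - 1)) (Set.Ioc 0 κ) ∧
    HasSum (fun i : ℕ × ℕ+ => u i.1 * ((-1) ^ (i.2 : ℕ) * κ ^ (2 * i.1 + e + 1 + (i.2 : ℕ)) *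
        Real.Gamma (2 * i.1 + e + 1) / Real.Gamma (2 * i.1 + e + 1 + ((i.2 : ℕ) + 1))))
      (∫ x in Set.Ioc 0 κ, g x * (Real.exp (x - κ) - 1)) := by
  have hp : ∀ j : ℕ, -1 < 2 * (j : ℝ) + e := fun j => by
    have : (0 : ℝ) ≤ j := by positivity
    linarith
  -- Only the even power is bounded by its value at `κ`; `x^e` is kept, as it may be singular at `0`
  -- but is integrable for `e > -1`.
  have hpow : ∀ j : ℕ, ∀ x ∈ Set.Ioc 0 κ, ‖u j * x ^ (2 * j + e)‖ ≤ |u j * κ ^ (2 * j)| * x ^ e := by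
    intro j x hx
    have h1 : x ^ (2 * (j : ℝ) + e) = x ^ (2 * j) * x ^ e := by
      rw [Real.rpow_add hx.1, ← Real.rpow_natCast]; push_cast; rfl
    have hx0 := hx.1
    rw [norm_mul, Real.norm_eq_abs, abs_mul, abs_of_pos (show 0 < κ ^ (2 * j) by positivity), h1,
      Real.norm_of_nonneg (by positivity), mul_assoc]
    gcongr
    exact hx.2
  have hxe : IntegrableOn (fun x : ℝ => x ^ e) (Set.Ioc 0 κ) := by
    simpa using integrableOn_rpow_mul_sub_pow he hκ.le 0
  constructor
  · refine (hxe.const_mul (∑' j, |u j * κ ^ (2 * j)|)).mono' (AEStronglyMeasurable.mul ?_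
      (by fun_prop : Measurable _).aestronglyMeasurable) ?_
    · refine aestronglyMeasurable_of_tendsto_ae atTop
        (f := fun n x => ∑ j ∈ Finset.range n, u j * x ^ (2 * (j : ℝ) + e))
        (fun n => (by fun_prop : Measurable _).aestronglyMeasurable) ?_
      exact (ae_restrict_iff' measurableSet_Ioc).2 (.of_forall fun x hx => (hg x hx).tendsto_sum_nat)
    · refine (ae_restrict_iff' measurableSet_Ioc).2 (.of_forall fun x hx => ?_)
      have h1 : ‖g x‖ ≤ (∑' j, |u j * κ ^ (2 * j)|) * x ^ e := by
        rw [← (hg x hx).tsum_eq]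
        exact tsum_of_norm_bounded (hu.hasSum.mul_right _) fun j => hpow j x hx
      have h2 : ‖Real.exp (x - κ) - 1‖ ≤ 1 := by
        have h3 : Real.exp (x - κ) ≤ 1 := Real.exp_le_one_iff.2 (by linarith [hx.2])
        rw [Real.norm_eq_abs, abs_le]
        constructor <;> linarith [Real.exp_pos (x - κ)]
      rw [norm_mul]
      exact (mul_le_of_le_one_right (norm_nonneg _) h2).trans h1
  have hF : ∀ i : ℕ × ℕ+, IntegrableOn (fun x : ℝ => u i.1 / ((i.2 : ℕ).factorial : ℝ) *
      (x ^ (2 * (i.1 : ℝ) + e) * (x - κ) ^ (i.2 : ℕ))) (Set.Ioc 0 κ) := fun i =>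
    (integrableOn_rpow_mul_sub_pow (hp _) hκ.le _).const_mul _
  have hval : ∀ x ∈ Set.Ioc 0 κ, g x * (Real.exp (x - κ) - 1) = ∑' i : ℕ × ℕ+,
      u i.1 / ((i.2 : ℕ).factorial : ℝ) * (x ^ (2 * (i.1 : ℝ) + e) * (x - κ) ^ (i.2 : ℕ)) := by
    intro x hx
    have h1 := hasSum_pnat_pow_div_factorial (x - κ)
    have h2 := summable_mul_of_summable_norm (hg x hx).summable.norm h1.summable.norm
    rw [← ((hg x hx).mul h1 h2).tsum_eq]
    refine tsum_congr fun i => ?_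
    ring
  rw [setIntegral_congr_fun measurableSet_Ioc hval]
  have hs := hasSum_integral_of_summable_integral_norm hF ?_
  · convert! hs using 2 with i
    have : ((i.2 : ℕ).factorial : ℝ) ≠ 0 := by positivity
    rw [integral_const_mul, setIntegral_rpow_mul_sub_pow (hp _) hκ]
    field_simp
  · have hb : Summable fun i : ℕ × ℕ+ => |u i.1 * κ ^ (2 * i.1)| *
        (κ ^ (i.2 : ℕ) / ((i.2 : ℕ).factorial : ℝ)) * ∫ x in Set.Ioc 0 κ, x ^ e :=
      (hu.mul_of_nonneg (hasSum_pnat_pow_div_factorial κ).summable (fun _ => abs_nonneg _)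
        (fun _ => by positivity)).mul_right _
    refine hb.of_nonneg_of_le (fun i => integral_nonneg fun x => norm_nonneg _) fun i => ?_
    rw [← integral_const_mul]
    refine setIntegral_mono_on (hF i).norm (hxe.const_mul _) measurableSet_Ioc fun x hx => ?_
    have h1 := hpow i.1 x hx
    have h2 : ‖(x - κ) ^ (i.2 : ℕ)‖ ≤ κ ^ (i.2 : ℕ) := by
      rw [norm_pow, Real.norm_eq_abs, abs_of_nonpos (by linarith [hx.2])]
      gcongr
      · linarith [hx.2]
      · linarith [hx.1]
    have hx0 := Real.rpow_nonneg hx.1.le e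
    calc _ = ‖u i.1 * x ^ (2 * (i.1 : ℝ) + e)‖ * ‖(x - κ) ^ (i.2 : ℕ)‖ /
          ((i.2 : ℕ).factorial : ℝ) := by
          simp only [norm_mul, norm_div, Real.norm_natCast]; ring
      _ ≤ |u i.1 * κ ^ (2 * i.1)| * x ^ e * κ ^ (i.2 : ℕ) / ((i.2 : ℕ).factorial : ℝ) := by gcongr
      _ = _ := by ring

/-- The second series carries `((x/(2s))²)^α`, whence the exponent `2α`. The exponents are written
`2j + 0` and `2j + 2α` to fit `hasSum_setIntegral_exp_sub_one_mul` with `e = 0` and `e = 2α`. -/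
theorem hasSum_vgDensity {α s x : ℝ} (hα : ∀ m : ℤ, α ≠ m) (hs : 0 < s) (hx : 0 < x) :
    ∃ y₁ y₂ : ℝ,
      HasSum (fun j : ℕ => (-1) ^ j / (j.factorial : ℝ) * Real.Gamma (α - j) / (2 * s) ^ (2 * j) /
        (2 * s * √Real.pi * Real.Gamma (α + 1 / 2)) * x ^ (2 * (j : ℝ) + 0)) y₁ ∧
      HasSum (fun j : ℕ => (-1) ^ j / (j.factorial : ℝ) * Real.Gamma (-α - j) / (2 * s) ^ (2 * j) /
        ((2 * s) ^ (2 * α) * (2 * s * √Real.pi * Real.Gamma (α + 1 / 2))) *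
          x ^ (2 * (j : ℝ) + 2 * α)) y₂ ∧
      vgDensity α s x = y₁ + y₂ := by
  have hα' : ∀ m : ℤ, -α ≠ m := fun m h => hα (-m) (by push_cast; linarith)
  have hz : 0 < (x / (2 * s)) ^ 2 := by positivity
  have h1 := ((summable_abs_Gamma_sub_nat hα (-(x / (2 * s)) ^ 2)).of_abs.hasSum).div_const
    (2 * s * √Real.pi * Real.Gamma (α + 1 / 2))
  have h2 := (((summable_abs_Gamma_sub_nat hα' (-(x / (2 * s)) ^ 2)).of_abs.hasSum).mul_left
    (((x / (2 * s)) ^ 2) ^ α)).div_const (2 * s * √Real.pi * Real.Gamma (α + 1 / 2))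
  rw [vgDensity, besselIntegral_eq hα hz, add_div]
  refine ⟨_, _, ?_, ?_, rfl⟩
  · convert! h1 using 2 with j
    rw [add_zero, show 2 * (j : ℝ) = ((2 * j : ℕ) : ℝ) by push_cast; rfl, Real.rpow_natCast,
      neg_pow ((x / (2 * s)) ^ 2) j, ← pow_mul, div_pow]
    ring
  · convert! h2 using 2 with j
    have e : ((x / (2 * s)) ^ 2) ^ α = x ^ (2 * α) / (2 * s) ^ (2 * α) := by
      rw [← Real.rpow_natCast, ← Real.rpow_mul (by positivity), Real.div_rpow hx.le (by positivity)]
      norm_num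
    rw [e, Real.rpow_add hx, show 2 * (j : ℝ) = ((2 * j : ℕ) : ℝ) by push_cast; rfl,
      Real.rpow_natCast, neg_pow ((x / (2 * s)) ^ 2) j, ← pow_mul, div_pow]
    ring

theorem summable_density_coeff {β s κ : ℝ} (hβ : ∀ m : ℤ, β ≠ m) (c : ℝ) :
    Summable fun j : ℕ => |(-1) ^ j / (j.factorial : ℝ) * Real.Gamma (β - j) / (2 * s) ^ (2 * j) /
      c * κ ^ (2 * j)| := by
  refine ((summable_abs_Gamma_sub_nat hβ (-(κ / (2 * s)) ^ 2)).mul_left |c⁻¹|).congr fun j => ?_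
  rw [← abs_mul, neg_pow _ j, ← pow_mul, div_pow]
  congr 1
  ring

/-! ### Matching the series with the integrals -/

/-- The part of the out-of-the-money term coming from the first quotient of Gamma functions. -/
noncomputable def firstTerm (α κ s : ℝ) (n₁ n₂ : ℕ) : ℝ :=
  (-1) ^ n₁ / (n₁.factorial : ℝ) * (firstGammaQuotient α n₁ n₂ * (κ / s) ^ n₁ * s ^ n₂) /
    (2 * Real.Gamma (α + 1 / 2))

/-- The part of the out-of-the-money term coming from the second quotient of Gamma functions. -/
noncomputable def secondTerm (α κ s : ℝ) (n₁ n₂ : ℕ) : ℝ :=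
  (-1) ^ n₁ / (n₁.factorial : ℝ) *
    (2 * secondGammaQuotient α n₁ n₂ * (κ / s) ^ (2 * (n₁ : ℝ) + 1 + 2 * α) * κ ^ n₂) /
    (2 * Real.Gamma (α + 1 / 2))

theorem firstTerm_add_odd {α κ s : ℝ} (hα : ∀ m : ℤ, α ≠ m) (hκ : 0 < κ) (hs : 0 < s) (n j : ℕ) :
    firstTerm α κ s (n + (2 * j + 1)) n =
      -((-1) ^ j / (j.factorial : ℝ) * Real.Gamma (α - j) / (2 * s) ^ (2 * j) /
        (2 * s * √Real.pi * Real.Gamma (α + 1 / 2)) *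
        ((-1) ^ n * κ ^ (2 * (j : ℝ) + 0 + 1 + n) * Real.Gamma (2 * j + 0 + 1) /
          Real.Gamma (2 * j + 0 + 1 + (n + 1)))) := by
  have e1 : κ ^ (2 * (j : ℝ) + 0 + 1 + n) = κ ^ (n + (2 * j + 1)) := by
    rw [← Real.rpow_natCast]; congr 1; push_cast; ring
  have e2 : Real.Gamma (2 * (j : ℝ) + 0 + 1) = (2 * j).factorial := by
    rw [← Real.Gamma_nat_eq_factorial]; push_cast; ring_nf
  have e3 : Real.Gamma (2 * (j : ℝ) + 0 + 1 + (n + 1)) = (n + (2 * j + 1)).factorial := by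
    rw [← Real.Gamma_nat_eq_factorial]; push_cast; ring_nf
  have e4 : (-1 : ℝ) ^ (n + (2 * j + 1)) = -(-1) ^ n := by
    rw [pow_add, pow_succ, pow_mul]; norm_num
  have h3 : √Real.pi ≠ 0 := by positivity
  rw [firstTerm, firstGammaQuotient_add_odd hα, div_eq_mul_inv (Real.Gamma (α - j)),
    inv_Gamma_half_sub_nat, e1, e2, e3, e4, div_pow, mul_pow,
    show s ^ (n + (2 * j + 1)) = s ^ n * s ^ (2 * j) * s by ring]
  generalize Real.Gamma (α + 1 / 2) = G
  generalize Real.Gamma (α - j) = G'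
  have h4 : ((n + (2 * j + 1)).factorial : ℝ) ≠ 0 := by positivity
  -- Both sides are divided by `G`, so if it is zero both are zero.
  by_cases hG : G = 0
  · simp [hG]
  field_simp

theorem secondTerm_eq {α κ s : ℝ} (hα : -1 / 2 < α) (hαZ : ∀ m : ℤ, α ≠ m) (hκ : 0 < κ)
    (hs : 0 < s) (j n : ℕ) :
    secondTerm α κ s j n =
      -((-1) ^ j / (j.factorial : ℝ) * Real.Gamma (-α - j) / (2 * s) ^ (2 * j) /
        ((2 * s) ^ (2 * α) * (2 * s * √Real.pi * Real.Gamma (α + 1 / 2))) *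
        ((-1) ^ n * κ ^ (2 * (j : ℝ) + 2 * α + 1 + n) * Real.Gamma (2 * j + 2 * α + 1) /
          Real.Gamma (2 * j + 2 * α + 1 + (n + 1)))) := by
  have e1 : κ ^ (2 * (j : ℝ) + 2 * α + 1 + n) = κ ^ (2 * (j : ℝ) + 1 + 2 * α) * κ ^ n := by
    rw [Real.rpow_add_natCast hκ.ne']; ring_nf
  have e2 : s ^ (2 * (j : ℝ) + 1 + 2 * α) = s ^ (2 * j) * s * s ^ (2 * α) := by
    rw [Real.rpow_add hs, Real.rpow_add_one hs.ne', ← Real.rpow_natCast]; push_cast; rfl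
  have e3 : (2 : ℝ) ^ (-(2 * (j : ℝ) + 2 * α)) = (2 ^ (2 * j) * 2 ^ (2 * α))⁻¹ := by
    rw [Real.rpow_neg two_pos.le, Real.rpow_add two_pos, ← Real.rpow_natCast]; push_cast; rfl
  have h3 : 0 < √Real.pi := by positivity
  rw [secondTerm, secondGammaQuotient_eq hα hαZ, e1, e3, Real.div_rpow hκ.le hs.le, e2,
    Real.mul_rpow two_pos.le hs.le, mul_pow]
  have h1 := Real.Gamma_pos_of_pos (show 0 < α + 1 / 2 by linarith)
  have h2 := Real.Gamma_pos_of_pos (show 0 < 2 * (j : ℝ) + 2 * α + 1 + (n + 1) by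
    have : (0 : ℝ) ≤ j := by positivity
    have : (0 : ℝ) ≤ n := by positivity
    linarith)
  have h4 := Real.rpow_pos_of_pos hs (2 * α)
  have h5 := Real.rpow_pos_of_pos two_pos (2 * α)
  have h6 := Real.rpow_pos_of_pos hκ (2 * (j : ℝ) + 1 + 2 * α)
  generalize Real.Gamma (-α - j) = G'
  field_simp

theorem firstTerm_add_right {α κ s : ℝ} (hα : -1 / 2 < α) (hs : 0 < s) (n d : ℕ) :
    firstTerm α κ s n (n + d) = (-κ) ^ n / (n.factorial : ℝ) *
      ∫ x in Set.Ioi 0, x ^ d / (d.factorial : ℝ) * vgDensity α s x := by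
  rw [firstTerm, firstGammaQuotient_add_right hα, integral_pow_mul_vgDensity hα hs, neg_pow κ,
    div_pow, pow_add]
  field_simp

/-- The exponential moment over the half line as the series of the half-line moments. -/
theorem hasSum_moment {f : ℝ → ℝ} (hf : Measurable f) (hf0 : ∀ x, 0 ≤ f x)
    (hint : Integrable fun x => f x * Real.exp x) :
    HasSum (fun d : ℕ => ∫ x in Set.Ioi 0, x ^ d / (d.factorial : ℝ) * f x)
      (∫ x in Set.Ioi 0, f x * Real.exp x) := by
  have h : ∀ x, HasSum (fun d : ℕ => x ^ d / (d.factorial : ℝ) * f x) (f x * Real.exp x) :=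
    fun x => by rw [mul_comm]; exact (hasSum_pow_div_factorial_exp x).mul_right _
  refine hasSum_integral_of_dominated_convergence (fun (d : ℕ) x => x ^ d / (d.factorial : ℝ) * f x)
    (fun d => (by fun_prop : Measurable _).aestronglyMeasurable)
    (fun d => (ae_restrict_iff' measurableSet_Ioi).2 (.of_forall fun x hx => ?_))
    (.of_forall fun x => (h x).summable) ?_ (.of_forall h)
  · have : (0 : ℝ) < x := hx
    exact (Real.norm_of_nonneg (mul_nonneg (by positivity) (hf0 x))).le
  · exact (hint.congr (.of_forall fun x => (h x).tsum_eq.symm)).integrableOn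

/-- The product of the series of `e^(-κ)` and of the moments, indexed by `(n₁, d)` with `n₂ = n₁ +
d`, covers exactly `n₁ ≤ n₂`. Restricting to `n₂ ≥ 1` removes only `(0, 0)`, whose term is `∫ f`;
this accounts for the `-1` in `e^(x-κ) - 1`. -/
theorem hasSum_firstTerm_of_le {α κ s : ℝ} (hα : -1 / 2 < α) (hs : 0 < s)
    (hint : Integrable fun x => vgDensity α s x * Real.exp x) :
    HasSum (fun n : ℕ × ℕ+ => if n.1 ≤ n.2 then firstTerm α κ s n.1 n.2 else 0)
      (Real.exp (-κ) * (∫ x in Set.Ioi 0, vgDensity α s x * Real.exp x) -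
        ∫ x in Set.Ioi 0, vgDensity α s x) := by
  have h1 := hasSum_pow_div_factorial_exp (-κ)
  have h2 := hasSum_moment (measurable_vgDensity α s) (vgDensity_nonneg hα hs) hint
  have h3 := h1.mul h2 (summable_mul_of_summable_norm h1.summable.norm h2.summable.norm)
  have hinj : Function.Injective fun n : ℕ × ℕ => (n.1, n.1 + n.2) := fun n m h => by
    simp only [Prod.mk.injEq] at h
    ext <;> omega
  have h4 : HasSum (fun n : ℕ × ℕ => if n.1 ≤ n.2 then firstTerm α κ s n.1 n.2 else 0)
      (Real.exp (-κ) * ∫ x in Set.Ioi 0, vgDensity α s x * Real.exp x) := by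
    rw [← hinj.hasSum_iff]
    · convert! h3 using 2 with n
      simp [firstTerm_add_right hα hs]
    · intro n hn
      rw [if_neg]
      exact fun h => hn ⟨(n.1, n.2 - n.1), by ext <;> simp; omega⟩
  have h5 := h4.sub (hasSum_ite_eq ((0, 0) : ℕ × ℕ) (∫ x in Set.Ioi 0, vgDensity α s x))
  have hinj' : Function.Injective fun n : ℕ × ℕ+ => (n.1, (n.2 : ℕ)) := fun n m h => by
    simp only [Prod.mk.injEq, PNat.coe_inj] at h
    exact Prod.ext h.1 h.2
  rw [← hinj'.hasSum_iff] at h5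
  · convert! h5 using 2 with n
    simp
  · rintro ⟨n₁, n₂⟩ hn
    have h0 : n₂ = 0 := by
      by_contra h0
      exact hn ⟨(n₁, ⟨n₂, Nat.pos_of_ne_zero h0⟩), rfl⟩
    subst h0
    rcases Nat.eq_zero_or_pos n₁ with rfl | hpos
    · have := firstTerm_add_right (κ := κ) hα hs 0 0
      simp at this
      simp [this]
    · simp [hpos.ne']

/-- Of the indices with `n₁ > n₂` only those with `n₁ = n₂ + 2j + 1` contribute; the pairs `(j, n₂)`
number the Beta integrals of the even part of the density. -/
theorem hasSum_firstTerm_of_lt {α κ s y : ℝ} (hα : ∀ m : ℤ, α ≠ m) (hκ : 0 < κ) (hs : 0 < s)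
    (h : HasSum (fun i : ℕ × ℕ+ => (-1) ^ i.1 / (i.1.factorial : ℝ) * Real.Gamma (α - i.1) /
        (2 * s) ^ (2 * i.1) / (2 * s * √Real.pi * Real.Gamma (α + 1 / 2)) *
        ((-1) ^ (i.2 : ℕ) * κ ^ (2 * (i.1 : ℝ) + 0 + 1 + (i.2 : ℕ)) * Real.Gamma (2 * i.1 + 0 + 1) /
          Real.Gamma (2 * i.1 + 0 + 1 + ((i.2 : ℕ) + 1)))) y) :
    HasSum (fun n : ℕ × ℕ+ => if n.1 ≤ n.2 then 0 else firstTerm α κ s n.1 n.2) (-y) := by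
  have hinj : Function.Injective fun i : ℕ × ℕ+ => ((i.2 : ℕ) + (2 * i.1 + 1), i.2) :=
    fun n m h => by
      simp only [Prod.mk.injEq] at h
      obtain ⟨h1, h2⟩ := h
      rw [h2] at h1
      exact Prod.ext (by omega) h2
  rw [← hinj.hasSum_iff]
  · convert! h.neg using 2 with i
    rw [Function.comp_apply, if_neg (by simp), firstTerm_add_odd hα hκ hs]
  · rintro ⟨n₁, n₂⟩ hn
    split_ifs with hle
    · rfl
    · obtain ⟨d, hd⟩ := Nat.exists_eq_add_of_lt (not_le.1 hle)
      simp only at hd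
      rcases Nat.even_or_odd' d with ⟨j, rfl | rfl⟩
      · exact absurd ⟨(j, n₂), by simp [hd, add_assoc]⟩ hn
      · simp only [hd, firstTerm]
        rw [show (n₂ : ℕ) + (2 * j + 1) + 1 = n₂ + (2 * j + 2) by ring, firstGammaQuotient_add_even]
        simp

/-- The normalized at-the-money call value as the out-of-the-money series. -/
theorem hasSum_integral_vgDensity_mul_max {α s κ : ℝ} (hα : -1 / 2 < α) (hαZ : ∀ m : ℤ, α ≠ m)
    (hs : 0 < s) (hκ : 0 < κ) (hint : Integrable fun x => vgDensity α s x * Real.exp x) :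
    HasSum (fun n : ℕ × ℕ+ => firstTerm α κ s n.1 n.2 + secondTerm α κ s n.1 n.2)
      (∫ x, vgDensity α s x * max (Real.exp (x - κ) - 1) 0) := by
  have hαZ' : ∀ m : ℤ, -α ≠ m := fun m h => hαZ (-m) (by push_cast; linarith)
  set f := vgDensity α s with hf
  have hfm : Measurable f := measurable_vgDensity α s
  have hf0 : ∀ x, 0 ≤ f x := vgDensity_nonneg hα hs
  choose! g₁ g₂ hg₁ hg₂ hg using fun (x : ℝ) (hx : 0 < x) => hasSum_vgDensity (s := s) hαZ hs hx
  obtain ⟨hi₁, hs₁⟩ := hasSum_setIntegral_exp_sub_one_mul (e := 0) hκ (by norm_num)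
    (summable_density_coeff hαZ _) fun x hx => hg₁ x hx.1
  obtain ⟨hi₂, hs₂⟩ := hasSum_setIntegral_exp_sub_one_mul (e := 2 * α) hκ (by linarith)
    (summable_density_coeff hαZ' _) fun x hx => hg₂ x hx.1
  have hA := hasSum_firstTerm_of_le (κ := κ) hα hs hint
  have hB := hasSum_firstTerm_of_lt hαZ hκ hs hs₁
  have hC := hs₂.neg
  have hfi : IntegrableOn f (Set.Ioi 0) := by
    refine hint.integrableOn.mono' hfm.aestronglyMeasurable
      ((ae_restrict_iff' measurableSet_Ioi).2 (.of_forall fun x hx => ?_))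
    rw [Real.norm_of_nonneg (hf0 x)]
    exact le_mul_of_one_le_right (hf0 x) (Real.one_le_exp (le_of_lt hx))
  have hexp : ∀ x, f x * (Real.exp (x - κ) - 1) = Real.exp (-κ) * (f x * Real.exp x) - f x :=
    fun x => by rw [sub_eq_add_neg x, Real.exp_add]; ring
  have hI : IntegrableOn (fun x => f x * (Real.exp (x - κ) - 1)) (Set.Ioi 0) := by
    simp only [hexp]
    exact (hint.integrableOn.const_mul _).sub hfi
  have hmax : ∫ x, f x * max (Real.exp (x - κ) - 1) 0 =
      ∫ x in Set.Ioi κ, f x * (Real.exp (x - κ) - 1) := by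
    rw [← integral_indicator measurableSet_Ioi]
    congr 1 with x
    by_cases hx : κ < x
    · rw [Set.indicator_of_mem (Set.mem_Ioi.2 hx), max_eq_left]
      rw [sub_nonneg, Real.one_le_exp_iff]
      linarith
    · rw [Set.indicator_of_notMem (by simpa using hx), max_eq_right, mul_zero]
      rw [sub_nonpos, Real.exp_le_one_iff]
      linarith
  have hsplit := setIntegral_union Set.Ioc_disjoint_Ioi_same measurableSet_Ioi
    (hI.mono_set (Set.Ioc_subset_Ioi_self (a := κ) (b := 0))) (hI.mono_set (Set.Ioi_subset_Ioi hκ.le))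
  rw [Set.Ioc_union_Ioi_eq_Ioi hκ.le] at hsplit
  have h0 : ∫ x in Set.Ioi 0, f x * (Real.exp (x - κ) - 1) =
      Real.exp (-κ) * (∫ x in Set.Ioi 0, f x * Real.exp x) - ∫ x in Set.Ioi 0, f x := by
    simp only [hexp]
    rw [integral_sub (hint.integrableOn.const_mul _) hfi, integral_const_mul]
  have h1 : ∫ x in Set.Ioc 0 κ, f x * (Real.exp (x - κ) - 1) =
      (∫ x in Set.Ioc 0 κ, g₁ x * (Real.exp (x - κ) - 1)) +
        ∫ x in Set.Ioc 0 κ, g₂ x * (Real.exp (x - κ) - 1) := by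
    rw [← integral_add hi₁ hi₂]
    refine setIntegral_congr_fun measurableSet_Ioc fun x hx => ?_
    rw [← add_mul, ← hg x hx.1]
  -- `hB` and `hC` enter with the negated integrals of the two parts of the density over `(0, κ]`,
  -- so the total is the integral over `(κ, ∞)`.
  convert! (hA.add hB).add hC using 1
  · funext n
    congr 1
    · split_ifs <;> simp
    · exact secondTerm_eq hα hαZ hκ hs _ _
  · rw [hmax]
    linarith

/-! ### The at-the-money model and the theorem -/

theorem martingaleAdjustment_isEquivalent {ν : ℝ} (hν : 0 < ν) :
    (fun s : ℝ => martingaleAdjustment s ν) ~[𝓝[>] 0] (fun s : ℝ => -s ^ 2 / 2) := by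
  have h1 : (fun u : ℝ => Real.log (1 + u)) ~[𝓝 0] (fun u => u) := by
    have h := (((hasDerivAt_id (0 : ℝ)).const_add 1).log (by simp)).isLittleO
    simpa [IsEquivalent] using! h
  have ht : Tendsto (fun s : ℝ => -(s ^ 2 * ν / 2)) (𝓝[>] 0) (𝓝 0) := by
    have : Continuous fun s : ℝ => -(s ^ 2 * ν / 2) := by fun_prop
    simpa using (this.tendsto 0).mono_left nhdsWithin_le_nhds
  have h2 := (IsEquivalent.refl (u := fun _ : ℝ => 1 / ν)).mul (h1.comp_tendsto ht)
  convert! h2 using 1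
  funext s
  simp only [Pi.mul_apply, Function.comp]
  field_simp

theorem callPayoff_terminalPrice_atTheMoney {K : ℝ} (hK : 0 < K) (r τ σ x : ℝ) :
    callPayoff (terminalPrice (forwardStrike K r τ) r τ (-σ ^ 2 / 2) x) K =
      K * max (Real.exp (x - σ ^ 2 * τ / 2) - 1) 0 := by
  rw [callPayoff, terminalPrice, forwardStrike, mul_assoc, ← Real.exp_add, mul_max_of_nonneg _ _ hK.le]
  congr 2
  · rw [mul_sub, mul_one]
    congr 3
    ring
  · simp

theorem mainTheorem9 {Ω : Type*} [MeasurableSpace Ω] (Q : Measure Ω) [IsProbabilityMeasure Q]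
    (S K r τ σ ν α : ℝ) (hK : 0 < K) (hτ : 0 < τ) (hσ : 0 < σ) (hν : 0 < ν)
    -- the martingale adjustment is defined
    (hσν : σ ^ 2 * ν < 2)
    (hα : α = τ / ν - 1 / 2) (hαZ : ∀ m : ℤ, α ≠ m)
    -- at the money forward
    (hSF : S = forwardStrike K r τ)
    -- `X` is the symmetric Variance Gamma process over the remaining time
    (X : Ω → ℝ) (hX : HasLaw X (vgLaw σ ν 0 τ) Q) :
    -- the approximation `-s² / 2` of the martingale adjustment, for small volatility `s`
    (fun s : ℝ => martingaleAdjustment s ν) ~[𝓝[>] 0] (fun s : ℝ => -s ^ 2 / 2) ∧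
    -- under it, the negative of the moneyness is `σ² τ / 2`
    -moneyness S K r τ (-σ ^ 2 / 2) = σ ^ 2 * τ / 2 ∧
    Integrable (fun a => callPayoff (terminalPrice S r τ (-σ ^ 2 / 2) (X a)) K) Q ∧
    -- the call value is the out-of-the-money series at this moneyness
    HasSum (fun n : ℕ × ℕ+ => forwardStrike K r τ / (2 * Real.Gamma (τ / ν)) *
        europeanOTMTerm α (-(σ ^ 2 * τ / 2)) (rescaledVol σ ν) n.1 n.2)
      (callValue Q X S K r τ (-σ ^ 2 / 2)) ∧
    -- and explicitly
    HasSum (fun n : ℕ × ℕ+ => S / (2 * Real.Gamma (τ / ν)) *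
        ((-1) ^ n.1 / (n.1.factorial : ℝ) *
          (firstGammaQuotient α n.1 n.2 *
              (σ * τ / Real.sqrt (2 * ν)) ^ n.1 * (σ * Real.sqrt (ν / 2)) ^ (n.2 : ℕ)
            + 2 * secondGammaQuotient α n.1 n.2 *
              (σ * τ / Real.sqrt (2 * ν)) ^ (2 * (n.1 : ℝ) + 1 + 2 * α) *
              (σ ^ 2 * τ / 2) ^ (n.2 : ℕ))))
      (callValue Q X S K r τ (-σ ^ 2 / 2)) := by
  have hα' : -1 / 2 < α := hα ▸ neg_half_lt_div_sub_half hν hτ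
  have hs := rescaledVol_pos hσ hν
  have hκ : 0 < σ ^ 2 * τ / 2 := by positivity
  have hF : 0 < forwardStrike K r τ := by unfold forwardStrike; positivity
  have hexp := integrable_exp_vgLaw hν hτ hσν
  have hint : Integrable fun x => vgDensity α (rescaledVol σ ν) x * Real.exp x := by
    rw [hα]; exact (integrable_vgLaw_iff hσ hν hτ).1 hexp
  have hpay : ∀ x, callPayoff (terminalPrice S r τ (-σ ^ 2 / 2) x) K =
      K * max (Real.exp (x - σ ^ 2 * τ / 2) - 1) 0 :=
    hSF ▸ callPayoff_terminalPrice_atTheMoney hK r τ σ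
  have hseries : HasSum (fun n : ℕ × ℕ+ => forwardStrike K r τ / (2 * Real.Gamma (τ / ν)) *
        europeanOTMTerm α (-(σ ^ 2 * τ / 2)) (rescaledVol σ ν) n.1 n.2)
      (callValue Q X S K r τ (-σ ^ 2 / 2)) := by
    have h := (hasSum_integral_vgDensity_mul_max hα' hαZ hs hκ hint).mul_left (forwardStrike K r τ)
    have hval : callValue Q X S K r τ (-σ ^ 2 / 2) = forwardStrike K r τ *
        ∫ x, vgDensity α (rescaledVol σ ν) x * max (Real.exp (x - σ ^ 2 * τ / 2) - 1) 0 := by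
      have hc := hX.integral_comp (f := fun x => forwardStrike K r τ *
        max (Real.exp (x - σ ^ 2 * τ / 2) - 1) 0) (by fun_prop : Measurable _).aestronglyMeasurable
      rw [integral_const_mul, integral_vgLaw hσ hν hτ, ← hα] at hc
      rw [← hc, callValue]
      refine integral_congr_ae (.of_forall fun a => ?_)
      simp only [hpay, Function.comp, forwardStrike]
      ring
    rw [hval]
    convert! h using 2 with n
    rw [europeanOTMTerm, firstTerm, secondTerm, neg_neg, hα, sub_add_cancel]
    ring
  refine ⟨martingaleAdjustment_isEquivalent hν, ?_, ?_, hseries, ?_⟩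
  · rw [moneyness, hSF, div_self hF.ne', Real.log_one]; ring
  · have h1 : Integrable (fun x => K * max (Real.exp (x - σ ^ 2 * τ / 2) - 1) 0)
        (vgLaw σ ν 0 τ) := by
      refine Integrable.const_mul ?_ _
      -- The normalised payoff is dominated by `e^(-κ) e^x`, which is integrable because `σ²ν < 2`.
      refine (hexp.const_mul (Real.exp (-(σ ^ 2 * τ / 2)))).mono'
        (by fun_prop : Measurable _).aestronglyMeasurable (.of_forall fun x => ?_)
      rw [Real.norm_of_nonneg (le_max_right _ _), ← Real.exp_add, neg_add_eq_sub]
      exact max_le (by linarith) (Real.exp_pos _).le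
    rw [← hX.map_eq] at h1
    simp only [hpay]
    exact h1.comp_aemeasurable hX.aemeasurable
  · convert! hseries using 2 with n
    have h1 : σ ^ 2 * τ / 2 / (σ * √(ν / 2)) = σ * τ / √(2 * ν) := by
      have h2 : √(2 * ν) = 2 * √(ν / 2) := by
        rw [show 2 * ν = 2 ^ 2 * (ν / 2) by ring, Real.sqrt_mul (by positivity),
          Real.sqrt_sq two_pos.le]
      have : 0 < √(ν / 2) := by positivity
      rw [h2]
      field_simp
    rw [europeanOTMTerm, neg_neg, rescaledVol, h1, hSF]
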